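/- Let $G=(V,E,\ell)$ be a finite undirected graph with $|V|=n$ and positive symmetric edge lengths $\ell(x,y)$, and let $v_0:V\to\mathbb{R}\cup\{*\}$ be a partial voltage assignment with set of terminals $T=\{x\in V: v_0(x)\neq *\}$ (the pair $(G,v_0)$ is called a partially-labeled graph). For $v\in\mathbb{R}^V$ put $$\|\mathrm{grad}_G[v]\|_\infty=\max_{(x,y)\in E}\frac{|v(x)-v(y)|}{\ell(x,y)}$$ (which is $0$ if $E=\emptyset$), and let $\|v(T)-v_0(T)\|_0$ be the number of terminals $t\in T$ with $v(t)\neq v_0(t)$. **Theorem.** There is an algorithm (called Outlier) that takes a positive integer $k$ and a partially-labeled graph $(G,v_0)$ and outputs an exact optimal solution $v$ of the program $$\min_{v\in\mathbb{R}^V}\ \|\mathrm{grad}_G[v]\|_\infty\qquad\text{subject to}\qquad \|v(T)-v_0(T)\|_0\le k,$$ and that runs in polynomial time: it is one fixed deterministic program for a real RAM (exact unit-cost addition, subtraction, multiplication, division and comparison of real numbers, with rational constants; unit-cost addition, subtraction and comparison of natural numbers; indirect addressing), and there is a polynomial $p$ such that on every input the program halts after at most $p(n)$ elementary steps. -/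

import Mathlib

/-! ### Partially labelled graphs and the outlier problem -/

/-- A partially labelled graph `(G, v₀)`: an undirected simple graph with positive symmetric edge
lengths, and a partial voltage assignment `label` (`none` marks a vertex without a label).
The values of `len` off the edges carry no meaning. -/
structure PartiallyLabeledGraph (V : Type*) where
  graph : SimpleGraph V
  len : V → V → ℝ
  len_symm : ∀ x y, graph.Adj x y → len x y = len y x
  len_pos : ∀ x y, graph.Adj x y → 0 < len x y
  label : V → Option ℝ

namespace PartiallyLabeledGraph

variable {V : Type*} (G : PartiallyLabeledGraph V)

/-- The terminals `T(v₀)`: the labelled vertices. -/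
def terminals : Set V := {x | G.label x ≠ none}

/-- The gradient of a complete voltage assignment `v` on the (oriented) edge `(x, y)`. -/
noncomputable def grad (v : V → ℝ) (x y : V) : ℝ := (v x - v y) / G.len x y

/-- `‖grad_G[v]‖_∞`, the largest absolute value of the gradient over the edges, each edge being
taken in both orientations. It is `0` if the graph has no edges. -/
noncomputable def gradNorm (v : V → ℝ) : ℝ := ⨆ d : G.graph.Dart, |G.grad v d.fst d.snd|

/-- `‖v(T) - v₀(T)‖₀`, the number of terminals at which `v` differs from its label. -/
noncomputable def labelDist (v : V → ℝ) : ℕ :=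
  {t | t ∈ G.terminals ∧ G.label t ≠ some (v t)}.ncard

/-- The feasible assignments: those that disagree with the labels on at most `k` terminals. -/
def feasible (k : ℕ) : Set (V → ℝ) := {v | G.labelDist v ≤ k}

/-- `v` is an exact solution of: minimise `‖grad_G[v]‖_∞` subject to `‖v(T) - v₀(T)‖₀ ≤ k`. -/
def IsOptimal (k : ℕ) (v : V → ℝ) : Prop :=
  v ∈ G.feasible k ∧ IsMinOn G.gradNorm (G.feasible k) v

end PartiallyLabeledGraph

/-! ### The real RAM

Programs of a real random access machine, written in structured form. The memory consists of
cells for natural numbers and of cells for real numbers. A cell is addressed by a fixed array name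
and two computed indices. Arithmetic is exact and every elementary operation costs one unit.
Natural numbers can be added, subtracted and compared (unit cost multiplication of natural numbers
is left out on purpose); real numbers can be added, subtracted, multiplied, divided and compared.
The constants are natural and rational numbers, and information flows from real to natural cells
only through comparisons. -/

namespace RealRAM

/-- A memory state: the value of the cell `a[i][j]`, for the two kinds of arrays. -/
structure State where
  nat : ℕ → ℕ → ℕ → ℕ
  real : ℕ → ℕ → ℕ → ℝ

/-- Overwrite the natural number cell `a[i][j]`. -/
def State.setNat (σ : State) (a i j x : ℕ) : State where
  nat := fun a' i' j' => if a' = a ∧ i' = i ∧ j' = j then x else σ.nat a' i' j'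
  real := σ.real

/-- Overwrite the real number cell `a[i][j]`. -/
noncomputable def State.setReal (σ : State) (a i j : ℕ) (x : ℝ) : State where
  nat := σ.nat
  real := fun a' i' j' => if a' = a ∧ i' = i ∧ j' = j then x else σ.real a' i' j'

/-- Expressions with natural number values; `get a i j` reads the cell `a[i][j]`. -/
inductive NatExp : Type
  | const (c : ℕ)
  | get (a : ℕ) (i j : NatExp)
  | add (e f : NatExp)
  | sub (e f : NatExp)

/-- Subtraction is truncated at `0`. -/
def NatExp.eval (σ : State) : NatExp → ℕ
  | .const c => c
  | .get a i j => σ.nat a (i.eval σ) (j.eval σ)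
  | .add e f => e.eval σ + f.eval σ
  | .sub e f => e.eval σ - f.eval σ

/-- The number of elementary operations in an evaluation. -/
def NatExp.cost : NatExp → ℕ
  | .const _ => 1
  | .get _ i j => i.cost + j.cost + 1
  | .add e f => e.cost + f.cost + 1
  | .sub e f => e.cost + f.cost + 1

/-- Expressions with real values. -/
inductive RealExp : Type
  | const (q : ℚ)
  | get (a : ℕ) (i j : NatExp)
  | add (e f : RealExp)
  | sub (e f : RealExp)
  | mul (e f : RealExp)
  | div (e f : RealExp)

/-- Division by `0` returns `0`. -/
noncomputable def RealExp.eval (σ : State) : RealExp → ℝ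
  | .const q => (q : ℝ)
  | .get a i j => σ.real a (i.eval σ) (j.eval σ)
  | .add e f => e.eval σ + f.eval σ
  | .sub e f => e.eval σ - f.eval σ
  | .mul e f => e.eval σ * f.eval σ
  | .div e f => e.eval σ / f.eval σ

/-- The number of elementary operations in an evaluation. -/
def RealExp.cost : RealExp → ℕ
  | .const _ => 1
  | .get _ i j => i.cost + j.cost + 1
  | .add e f => e.cost + f.cost + 1
  | .sub e f => e.cost + f.cost + 1
  | .mul e f => e.cost + f.cost + 1
  | .div e f => e.cost + f.cost + 1

/-- Tests. -/
inductive Test : Type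
  | natLe (e f : NatExp)
  | realLe (e f : RealExp)
  | neg (b : Test)
  | conj (b c : Test)

/-- A test succeeds in a state. -/
def Test.Holds (σ : State) : Test → Prop
  | .natLe e f => e.eval σ ≤ f.eval σ
  | .realLe e f => e.eval σ ≤ f.eval σ
  | .neg b => ¬ b.Holds σ
  | .conj b c => b.Holds σ ∧ c.Holds σ

/-- The number of elementary operations in a test. -/
def Test.cost : Test → ℕ
  | .natLe e f => e.cost + f.cost + 1
  | .realLe e f => e.cost + f.cost + 1
  | .neg b => b.cost + 1
  | .conj b c => b.cost + c.cost + 1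

/-- Programs: `setNat a i j e` is the assignment `a[i][j] := e`, `loop b P` is
`while b do P`. -/
inductive Program : Type
  | skip
  | setNat (a : ℕ) (i j e : NatExp)
  | setReal (a : ℕ) (i j : NatExp) (e : RealExp)
  | seq (P Q : Program)
  | cond (b : Test) (P Q : Program)
  | loop (b : Test) (P : Program)

/-- `Runs P σ τ t`: started in the state `σ`, the program `P` halts in the state `τ` after `t`
elementary steps. -/
inductive Runs : Program → State → State → ℕ → Prop
  | skip (σ : State) : Runs .skip σ σ 1
  | setNat (a : ℕ) (i j e : NatExp) (σ : State) :
      Runs (.setNat a i j e) σ (σ.setNat a (i.eval σ) (j.eval σ) (e.eval σ))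
        (i.cost + j.cost + e.cost + 1)
  | setReal (a : ℕ) (i j : NatExp) (e : RealExp) (σ : State) :
      Runs (.setReal a i j e) σ (σ.setReal a (i.eval σ) (j.eval σ) (e.eval σ))
        (i.cost + j.cost + e.cost + 1)
  | seq {P Q : Program} {σ τ ρ : State} {s t : ℕ} (hP : Runs P σ τ s) (hQ : Runs Q τ ρ t) :
      Runs (.seq P Q) σ ρ (s + t)
  | condTrue {b : Test} {P Q : Program} {σ τ : State} {t : ℕ} (hb : b.Holds σ)
      (hP : Runs P σ τ t) : Runs (.cond b P Q) σ τ (b.cost + t)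
  | condFalse {b : Test} {P Q : Program} {σ τ : State} {t : ℕ} (hb : ¬ b.Holds σ)
      (hQ : Runs Q σ τ t) : Runs (.cond b P Q) σ τ (b.cost + t)
  | loopStop {b : Test} {P : Program} {σ : State} (hb : ¬ b.Holds σ) :
      Runs (.loop b P) σ σ b.cost
  | loopStep {b : Test} {P : Program} {σ τ ρ : State} {s t : ℕ} (hb : b.Holds σ)
      (hP : Runs P σ τ s) (hL : Runs (.loop b P) τ ρ t) :
      Runs (.loop b P) σ ρ (b.cost + s + t)

/-- The machine is deterministic. -/
theorem Runs.unique {P : Program} {σ τ : State} {t : ℕ} (h : Runs P σ τ t) :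
    ∀ {τ' : State} {t' : ℕ}, Runs P σ τ' t' → τ = τ' ∧ t = t' := by
  induction h with
  | skip σ => intro _ _ h'; cases h'; exact ⟨rfl, rfl⟩
  | setNat a i j e σ => intro _ _ h'; cases h'; exact ⟨rfl, rfl⟩
  | setReal a i j e σ => intro _ _ h'; cases h'; exact ⟨rfl, rfl⟩
  | seq _ _ ihP ihQ =>
    intro _ _ h'
    cases h' with
    | seq h1 h2 =>
      obtain ⟨rfl, rfl⟩ := ihP h1
      obtain ⟨rfl, rfl⟩ := ihQ h2
      exact ⟨rfl, rfl⟩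
  | condTrue hb _ ih =>
    intro _ _ h'
    cases h' with
    | condTrue _ h1 => obtain ⟨rfl, rfl⟩ := ih h1; exact ⟨rfl, rfl⟩
    | condFalse hb' _ => exact absurd hb hb'
  | condFalse hb _ ih =>
    intro _ _ h'
    cases h' with
    | condTrue hb' _ => exact absurd hb' hb
    | condFalse _ h1 => obtain ⟨rfl, rfl⟩ := ih h1; exact ⟨rfl, rfl⟩
  | loopStop hb =>
    intro _ _ h'
    cases h' with
    | loopStop _ => exact ⟨rfl, rfl⟩
    | loopStep hb' _ _ => exact absurd hb' hb
  | loopStep hb _ _ ihP ihL =>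
    intro _ _ h'
    cases h' with
    | loopStop hb' => exact absurd hb hb'
    | loopStep _ h1 h2 =>
      obtain ⟨rfl, rfl⟩ := ihP h1
      obtain ⟨rfl, rfl⟩ := ihL h2
      exact ⟨rfl, rfl⟩

open Classical in
/-- The memory that holds the input `(k, (G, v₀))`, for a graph with vertices `0, …, n - 1`.
Natural number arrays: `0[0][0] = n`, `0[0][1] = k`, `1[i][j] = 1` if `i` and `j` are adjacent,
`2[i][0] = 1` if `i` is a terminal. Real arrays: `0[i][j]` is the length of the edge `(i, j)`,
`1[i][0]` is the label of the terminal `i`. All other cells are `0`. -/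
noncomputable def input {n : ℕ} (k : ℕ) (G : PartiallyLabeledGraph (Fin n)) : State where
  nat := fun a i j =>
    if a = 0 ∧ i = 0 ∧ j = 0 then n
    else if a = 0 ∧ i = 0 ∧ j = 1 then k
    else if a = 1 ∧ (∃ x y : Fin n, x.val = i ∧ y.val = j ∧ G.graph.Adj x y) then 1
    else if a = 2 ∧ j = 0 ∧ (∃ x : Fin n, x.val = i ∧ x ∈ G.terminals) then 1
    else 0
  real := fun a i j =>
    if h : i < n ∧ j < n ∧ a = 0 then
      if G.graph.Adj ⟨i, h.1⟩ ⟨j, h.2.1⟩ then G.len ⟨i, h.1⟩ ⟨j, h.2.1⟩ else 0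
    else if h : i < n ∧ j = 0 ∧ a = 1 then (G.label ⟨i, h.1⟩).getD 0
    else 0

/-- The output of a halted program: the voltages stored in the real array `2`. -/
def State.output (n : ℕ) (σ : State) : Fin n → ℝ := fun i => σ.real 2 i.val 0

end RealRAM

/-! Fix the set of terminals that keep their labels `L`, and let `D` be the shortest-path distance.
An extension with gradient `α ≥ 0` exists exactly when `L y - L x ≤ α * D x y` for all kept `x`, `y`
at finite distance; the McShane formula `u x = min (L y + α * D y x)` then provides one. Hence the
optimal value is `0` or one of the at most `n ^ 2` quotients `(L y - L x) / D x y`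
(`exists_quotient`), and all of them can be tried.

For a fixed `α`, call `(x, y)` a conflict if `L y - L x > α * D x y`. The question is whether at
most `k` vertices meet all conflicts. Vertex cover is hard in general, but by the triangle
inequality conflict is a transitive relation (`Conflict.trans`), and for such relations the problem
reduces to bipartite matching between two copies of the vertex set. Transitivity makes every cover
at least as large as every matching (`Inv.card_owned_le`). Conversely, a cover in the two copies
projects to a cover of the vertices that is no larger.

The matching comes from an auction: a vertex that owns nothing bids for a cheapest partner, raising
its price by one, until the price exceeds `n`. The `n` prices miss some level `h` in `1, ..., n +
1`, and cutting the prices at `h` yields a cover no larger than the matching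
(`Inv.exists_card_removed_le`). The machine need not know which level is right: it tries them all
and keeps the best extension that drops at most `k` terminals.

Running time is separated from correctness. The algorithm is written with `for` loops of length `n +
c` only, so a polynomial bound follows by structural induction (`runs_compile`), and correctness is
proved by loop invariants for the denotation `den`. -/

namespace RealRAM

/-! ### Programs with `for` loops and their polynomial running time -/

/-- Iterate `f 0`, `f 1`, …, `f (m - 1)`. -/
def iter {α : Type*} (f : ℕ → α → α) : ℕ → α → α
  | 0, x => x
  | m + 1, x => f m (iter f m x)

/-- Programs with `for` loops only: `rep c P` runs `P` for the values `0, …, n + c - 1` of a loop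
counter. Assignments are to the natural number arrays `4, 5, …` and to the real arrays `2, 3, …`. -/
inductive ForProgram : Type
  | skip
  | setNat (a : ℕ) (i j e : NatExp)
  | setReal (a : ℕ) (i j : NatExp) (e : RealExp)
  | seq (P Q : ForProgram)
  | cond (b : Test) (P Q : ForProgram)
  | rep (c : ℕ) (P : ForProgram)

/-- The state `σ` with the loop counters `ρ` in the natural number array `3`. -/
def State.withCounters (ρ : List ℕ) (σ : State) : State where
  nat := fun a i j => if a = 3 then (if j = 0 then ρ.getD i 0 else 0) else σ.nat a i j
  real := σ.real

/-- The loop counter of the `d`-th enclosing loop, counted from the outside. -/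
def ctr (d : ℕ) : NatExp := .get 3 (.const d) (.const 0)

namespace ForProgram

/-- The state transformation of a program, for given values of the outer loop counters. -/
noncomputable def den : ForProgram → List ℕ → State → State
  | .skip, _, σ => σ
  | .setNat a i j e, ρ, σ => σ.setNat (a + 4) (i.eval (σ.withCounters ρ))
      (j.eval (σ.withCounters ρ)) (e.eval (σ.withCounters ρ))
  | .setReal a i j e, ρ, σ => σ.setReal (a + 2) (i.eval (σ.withCounters ρ))
      (j.eval (σ.withCounters ρ)) (e.eval (σ.withCounters ρ))
  | .seq P Q, ρ, σ => Q.den ρ (P.den ρ σ)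
  | .cond b P Q, ρ, σ =>
      open Classical in if b.Holds (σ.withCounters ρ) then P.den ρ σ else Q.den ρ σ
  | .rep c P, ρ, σ => iter (fun i τ => P.den (ρ ++ [i]) τ) (σ.nat 0 0 0 + c) σ

/-- Translation into the language of the machine; `d` is the number of outer loops. -/
def compile : ForProgram → ℕ → Program
  | .skip, _ => .skip
  | .setNat a i j e, _ => .setNat (a + 4) i j e
  | .setReal a i j e, _ => .setReal (a + 2) i j e
  | .seq P Q, d => .seq (P.compile d) (Q.compile d)
  | .cond b P Q, d => .cond b (P.compile d) (Q.compile d)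
  | .rep c P, d =>
      .seq (.loop (.neg (.natLe (.add (.get 0 (.const 0) (.const 0)) (.const c)) (ctr d)))
        (.seq (P.compile (d + 1))
          (.setNat 3 (.const d) (.const 0) (.add (ctr d) (.const 1)))))
        (.setNat 3 (.const d) (.const 0) (.const 0))

/-- The natural number arrays that a program assigns to. -/
def natWrites : ForProgram → List ℕ
  | .setNat a _ _ _ => [a + 4]
  | .seq P Q => P.natWrites ++ Q.natWrites
  | .cond _ P Q => P.natWrites ++ Q.natWrites
  | .rep _ P => P.natWrites
  | _ => []

/-- The real arrays that a program assigns to. -/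
def realWrites : ForProgram → List ℕ
  | .setReal a _ _ _ => [a + 2]
  | .seq P Q => P.realWrites ++ Q.realWrites
  | .cond _ P Q => P.realWrites ++ Q.realWrites
  | .rep _ P => P.realWrites
  | _ => []

/-- The states `σ` and `τ` agree on all arrays that `P` does not assign to. -/
structure Frame (P : ForProgram) (σ τ : State) : Prop where
  nat : ∀ a ∉ P.natWrites, τ.nat a = σ.nat a
  real : ∀ a ∉ P.realWrites, τ.real a = σ.real a

theorem Frame.refl (P : ForProgram) (σ : State) : P.Frame σ σ := ⟨fun _ _ => rfl, fun _ _ => rfl⟩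

theorem Frame.trans {P : ForProgram} {σ τ υ : State} (h : P.Frame σ τ) (h' : P.Frame τ υ) :
    P.Frame σ υ :=
  ⟨fun a ha => (h'.nat a ha).trans (h.nat a ha), fun a ha => (h'.real a ha).trans (h.real a ha)⟩

/-- Because of this, a loop invariant has to mention only those arrays that the loop body writes. -/
theorem frame_den (P : ForProgram) : ∀ ρ σ, P.Frame σ (P.den ρ σ) := by
  induction P with
  | skip => exact fun _ _ => Frame.refl _ _
  | setNat a i j e =>
    refine fun ρ σ => ⟨fun b hb => ?_, fun b hb => rfl⟩
    funext x y
    have : b ≠ a + 4 := by simpa [natWrites] using hb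
    simp [den, State.setNat, this]
  | setReal a i j e =>
    refine fun ρ σ => ⟨fun b hb => rfl, fun b hb => ?_⟩
    funext x y
    have : b ≠ a + 2 := by simpa [realWrites] using hb
    simp [den, State.setReal, this]
  | seq P Q ihP ihQ =>
    intro ρ σ
    refine ⟨fun a ha => ?_, fun a ha => ?_⟩
    · simp only [natWrites, List.mem_append, not_or] at ha
      exact ((ihQ ρ _).nat a ha.2).trans ((ihP ρ σ).nat a ha.1)
    · simp only [realWrites, List.mem_append, not_or] at ha
      exact ((ihQ ρ _).real a ha.2).trans ((ihP ρ σ).real a ha.1)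
  | cond b P Q ihP ihQ =>
    intro ρ σ
    refine ⟨fun a ha => ?_, fun a ha => ?_⟩
    · simp only [natWrites, List.mem_append, not_or] at ha
      rw [den]
      split_ifs
      exacts [(ihP ρ σ).nat a ha.1, (ihQ ρ σ).nat a ha.2]
    · simp only [realWrites, List.mem_append, not_or] at ha
      rw [den]
      split_ifs
      exacts [(ihP ρ σ).real a ha.1, (ihQ ρ σ).real a ha.2]
  | rep c P ih =>
    intro ρ σ
    have key : ∀ m, P.Frame σ (iter (fun i τ => P.den (ρ ++ [i]) τ) m σ) := by
      intro m
      induction m with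
      | zero => exact Frame.refl _ _
      | succ m hm => exact hm.trans (ih _ _)
    exact ⟨(key _).nat, (key _).real⟩

/-- Assignments shift the array number, by 4 for natural numbers and by 2 for reals, whereas reads
do not. The input arrays and the counter array `3` are thus out of reach, and loop lengths cannot
change during a run. -/
theorem four_le_of_mem_natWrites {P : ForProgram} {a : ℕ} (h : a ∈ P.natWrites) : 4 ≤ a := by
  induction P with
  | setNat b i j e => simp only [natWrites, List.mem_singleton] at h; omega
  | seq P Q ihP ihQ => exact (List.mem_append.1 h).elim ihP ihQ
  | cond b P Q ihP ihQ => exact (List.mem_append.1 h).elim ihP ihQ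
  | rep c P ih => exact ih h
  | _ => simp [natWrites] at h

/-- The size of the input is never overwritten. -/
theorem den_size (P : ForProgram) (ρ : List ℕ) (σ : State) :
    (P.den ρ σ).nat 0 0 0 = σ.nat 0 0 0 := by
  rw [(P.frame_den ρ σ).nat 0 fun h => by simpa using four_le_of_mem_natWrites h]

theorem Frame.size {P : ForProgram} {σ τ : State} (h : P.Frame σ τ) :
    τ.nat 0 0 0 = σ.nat 0 0 0 := by
  rw [h.nat 0 fun h => by simpa using four_le_of_mem_natWrites h]

/-- Induction along a `for` loop. -/
theorem den_rep_induct {P : ForProgram} {c n : ℕ} {ρ : List ℕ} {σ : State} (I : ℕ → State → Prop)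
    (hn : σ.nat 0 0 0 = n) (h0 : I 0 σ)
    (hs : ∀ i τ, i < n + c → P.Frame σ τ → I i τ → I (i + 1) (P.den (ρ ++ [i]) τ)) :
    I (n + c) ((rep c P).den ρ σ) := by
  subst hn
  have key : ∀ m, m ≤ σ.nat 0 0 0 + c →
      P.Frame σ (iter (fun i τ => P.den (ρ ++ [i]) τ) m σ) ∧
      I m (iter (fun i τ => P.den (ρ ++ [i]) τ) m σ) := by
    intro m
    induction m with
    | zero => exact fun _ => ⟨Frame.refl _ _, h0⟩
    | succ m ih =>
      intro hm
      obtain ⟨h1, h2⟩ := ih (by omega)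
      exact ⟨h1.trans (P.frame_den _ _), hs m _ (by omega) h1 h2⟩
  exact (key _ le_rfl).2

theorem withCounters_setNat (ρ : List ℕ) (σ : State) (a i j x : ℕ) :
    (σ.setNat (a + 4) i j x).withCounters ρ = (σ.withCounters ρ).setNat (a + 4) i j x := by
  simp only [State.withCounters, State.setNat, State.mk.injEq, and_true]
  funext b y z
  by_cases hb : b = 3
  · subst hb; simp
  · simp [hb]

theorem setCounter (ρ : List ℕ) (σ : State) (x y : ℕ) :
    (σ.withCounters (ρ ++ [x])).setNat 3 ρ.length 0 y = σ.withCounters (ρ ++ [y]) := by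
  simp only [State.withCounters, State.setNat, State.mk.injEq, and_true]
  funext b i j
  by_cases hb : b = 3
  · subst hb
    by_cases hj : j = 0
    · subst hj
      by_cases hi : i = ρ.length
      · subst hi; simp
      · rcases lt_or_gt_of_ne hi with h | h
        · simp [hi, List.getElem?_append_left h]
        · obtain ⟨r, hr⟩ : ∃ r, i - ρ.length = r + 1 := ⟨i - ρ.length - 1, by omega⟩
          simp [hi, List.getElem?_append_right h.le, hr]
    · simp [hj]
  · simp [hb]

/-- Absent counters read as `0`. A loop may therefore start without initialising its counter,
provided that every loop resets it at the end. -/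
theorem withCounters_append_zero (ρ : List ℕ) (σ : State) :
    σ.withCounters (ρ ++ [0]) = σ.withCounters ρ := by
  simp only [State.withCounters, State.mk.injEq, and_true]
  funext b i j
  rcases lt_trichotomy i ρ.length with h | h | h
  · simp [List.getElem?_append_left h]
  · subst h; simp
  · obtain ⟨r, hr⟩ : ∃ r, i - ρ.length = r + 1 := ⟨i - ρ.length - 1, by omega⟩
    simp [List.getElem?_append_right h.le, hr, h.le]

theorem eval_ctr_last (ρ : List ℕ) (x : ℕ) (σ : State) :
    (ctr ρ.length).eval (σ.withCounters (ρ ++ [x])) = x := by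
  simp [ctr, NatExp.eval, State.withCounters]

/-- A program with `for` loops only takes polynomial time. -/
theorem runs_compile (P : ForProgram) : ∀ d : ℕ, ∃ p : Polynomial ℕ, ∀ (ρ : List ℕ) (σ : State),
    ρ.length = d → ∃ t, Runs (P.compile d) (σ.withCounters ρ) ((P.den ρ σ).withCounters ρ) t ∧
      t ≤ p.eval (σ.nat 0 0 0) := by
  induction P with
  | skip => exact fun d => ⟨1, fun ρ σ _ => ⟨1, Runs.skip _, by simp⟩⟩
  | setNat a i j e =>
    intro d
    refine ⟨Polynomial.C (i.cost + j.cost + e.cost + 1), fun ρ σ _ =>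
      ⟨i.cost + j.cost + e.cost + 1, ?_, ?_⟩⟩
    · rw [den, withCounters_setNat]; exact Runs.setNat _ _ _ _ _
    · simp
  | setReal a i j e =>
    intro d
    refine ⟨Polynomial.C (i.cost + j.cost + e.cost + 1), fun ρ σ _ =>
      ⟨i.cost + j.cost + e.cost + 1, ?_, ?_⟩⟩
    · exact Runs.setReal _ _ _ _ _
    · simp
  | seq P Q ihP ihQ =>
    intro d
    obtain ⟨p, hp⟩ := ihP d
    obtain ⟨q, hq⟩ := ihQ d
    refine ⟨p + q, fun ρ σ hρ => ?_⟩
    obtain ⟨s, hs, hs'⟩ := hp ρ σ hρ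
    obtain ⟨t, ht, ht'⟩ := hq ρ (P.den ρ σ) hρ
    rw [den_size] at ht'
    exact ⟨s + t, Runs.seq hs ht, by rw [Polynomial.eval_add]; omega⟩
  | cond b P Q ihP ihQ =>
    intro d
    obtain ⟨p, hp⟩ := ihP d
    obtain ⟨q, hq⟩ := ihQ d
    refine ⟨Polynomial.C b.cost + p + q, fun ρ σ hρ => ?_⟩
    obtain ⟨s, hs, hs'⟩ := hp ρ σ hρ
    obtain ⟨t, ht, ht'⟩ := hq ρ σ hρ
    by_cases h : b.Holds (σ.withCounters ρ)
    · refine ⟨b.cost + s, ?_, by simp only [Polynomial.eval_add, Polynomial.eval_C]; omega⟩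
      rw [den, if_pos h]
      exact Runs.condTrue h hs
    · refine ⟨b.cost + t, ?_, by simp only [Polynomial.eval_add, Polynomial.eval_C]; omega⟩
      rw [den, if_neg h]
      exact Runs.condFalse h ht
  | rep c P ih =>
    intro d
    obtain ⟨p, hp⟩ := ih (d + 1)
    set f : List ℕ → ℕ → State → State := fun ρ i τ => P.den (ρ ++ [i]) τ with hf
    set b : Test := .neg (.natLe (.add (.get 0 (.const 0) (.const 0)) (.const c)) (ctr d)) with hb
    set B : Program := .seq (P.compile (d + 1))
          (.setNat 3 (.const d) (.const 0) (.add (ctr d) (.const 1))) with hB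
    have hbody : ∀ (ρ : List ℕ) (σ : State) (x : ℕ), ρ.length = d → ∃ t,
        Runs B (σ.withCounters (ρ ++ [x])) ((f ρ x σ).withCounters (ρ ++ [x + 1])) t ∧
          t ≤ p.eval (σ.nat 0 0 0) + 8 := by
      intro ρ σ x hρ
      obtain ⟨t, ht, ht'⟩ := hp (ρ ++ [x]) σ (by simp [hρ])
      -- Incrementing the counter costs 8 steps; resetting it, below, costs 4.
      refine ⟨t + 8, Runs.seq ht ?_, by omega⟩
      have := Runs.setNat 3 (.const d) (.const 0) (.add (ctr d) (.const 1))
        ((f ρ x σ).withCounters (ρ ++ [x]))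
      subst hρ
      simp only [NatExp.eval, eval_ctr_last, setCounter] at this
      exact this
    have hiter : ∀ (ρ : List ℕ) (σ : State) (m : ℕ),
        (iter (f ρ) m σ).nat 0 0 0 = σ.nat 0 0 0 := by
      intro ρ σ m
      induction m with
      | zero => rfl
      | succ m hm => exact (den_size _ _ _).trans hm
    have hloop : ∀ (ρ : List ℕ) (σ : State), ρ.length = d → ∀ r m, m + r = σ.nat 0 0 0 + c →
        ∃ t, Runs (.loop b B) ((iter (f ρ) m σ).withCounters (ρ ++ [m]))
          ((iter (f ρ) (m + r) σ).withCounters (ρ ++ [m + r])) t ∧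
          t ≤ r * (b.cost + p.eval (σ.nat 0 0 0) + 8) + b.cost := by
      intro ρ σ hρ r
      have hold : ∀ m, b.Holds ((iter (f ρ) m σ).withCounters (ρ ++ [m])) ↔
          m < σ.nat 0 0 0 + c := by
        intro m
        subst hρ
        rw [← hiter ρ σ m]
        simp only [hb, Test.Holds, NatExp.eval, eval_ctr_last, not_le]
        rfl
      induction r with
      | zero =>
        intro m hm
        exact ⟨_, Runs.loopStop (by rw [hold]; omega), by omega⟩
      | succ r ihr =>
        intro m hm
        obtain ⟨s, hs, hs'⟩ := hbody ρ (iter (f ρ) m σ) m hρ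
        obtain ⟨t, ht, ht'⟩ := ihr (m + 1) (by omega)
        rw [hiter] at hs'
        refine ⟨b.cost + s + t, ?_, ?_⟩
        · have e : m + (r + 1) = m + 1 + r := by omega
          rw [e]
          exact Runs.loopStep (by rw [hold]; omega) hs ht
        · rw [Nat.succ_mul]; omega
    refine ⟨(Polynomial.X + Polynomial.C c) * (Polynomial.C b.cost + p + 8) +
      Polynomial.C b.cost + 4, fun ρ σ hρ => ?_⟩
    obtain ⟨t, ht, ht'⟩ := hloop ρ σ hρ (σ.nat 0 0 0 + c) 0 (by omega)
    refine ⟨t + 4, ?_, ?_⟩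
    · rw [withCounters_append_zero] at ht
      refine Runs.seq ht ?_
      have := Runs.setNat 3 (.const d) (.const 0) (.const 0)
        ((iter (f ρ) (0 + (σ.nat 0 0 0 + c)) σ).withCounters (ρ ++ [0 + (σ.nat 0 0 0 + c)]))
      subst hρ
      simp only [NatExp.eval, setCounter, withCounters_append_zero] at this
      rw [Nat.zero_add] at this ⊢
      exact this
    · have e8 : Polynomial.eval (σ.nat 0 0 0) (8 : Polynomial ℕ) = 8 := Polynomial.eval_ofNat 8 _
      have e4 : Polynomial.eval (σ.nat 0 0 0) (4 : Polynomial ℕ) = 4 := Polynomial.eval_ofNat 4 _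
      simp only [Polynomial.eval_add, Polynomial.eval_mul, Polynomial.eval_C, Polynomial.eval_X,
        e8, e4]
      omega

end ForProgram

end RealRAM

/-! ### Bipartite matching by auction -/

namespace Auction

/-- The invariants of the auction for the relation `C` on `0, …, n - 1`: `p j` is the price of `j`,
and `o j = i + 1` if `j` is owned by `i`. -/
structure Inv (n : ℕ) (C : ℕ → ℕ → Prop) (p o : ℕ → ℕ) : Prop where
  rel : ∀ j < n, ∀ i, o j = i + 1 → C i j
  slack : ∀ j < n, ∀ i, o j = i + 1 → ∀ l < n, C i l → p j ≤ p l + 1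
  inj : ∀ j < n, ∀ l < n, o j = o l → o j ≠ 0 → j = l
  pos : ∀ j < n, 0 < p j → o j ≠ 0
  bound : ∀ j < n, p j ≤ n + 1

/-- `i` may bid for `j`: it owns nothing, and `j` is a cheapest partner, of price at most `n`. -/
structure CanBid (n : ℕ) (C : ℕ → ℕ → Prop) (p o : ℕ → ℕ) (i j : ℕ) : Prop where
  free : ∀ l < n, o l ≠ i + 1
  cheapest : ∀ l < n, C i l → p j ≤ p l
  rel : C i j
  price : p j ≤ n

variable {n : ℕ} {C : ℕ → ℕ → Prop} {p o : ℕ → ℕ}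

/-- Only the price of `j` rises, which can violate `slack` only for the owner of `j`. That owner is
now `i`, for whom `j` was cheapest before the increase by one. A previous owner of `j` simply
becomes free. -/
theorem Inv.bid {i j : ℕ} (h : Inv n C p o) (hb : CanBid n C p o i j) :
    Inv n C (Function.update p j (p j + 1)) (Function.update o j (i + 1)) := by
  have mono : ∀ l, p l ≤ Function.update p j (p j + 1) l := by
    intro l
    by_cases hl : l = j
    · subst hl; simp
    · simp [hl]
  refine ⟨?_, ?_, ?_, ?_, ?_⟩
  · intro l hl x hx
    by_cases hlj : l = j
    · subst hlj
      obtain rfl : i = x := by simpa using hx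
      exact hb.rel
    · exact h.rel l hl x (by simpa [hlj] using hx)
  · intro l hl x hx m hm hxm
    by_cases hlj : l = j
    · subst hlj
      obtain rfl : i = x := by simpa using hx
      have := hb.cheapest m hm hxm
      have := mono m
      simp only [Function.update_self]; omega
    · have h1 := h.slack l hl x (by simpa [hlj] using hx) m hm hxm
      have h2 := mono m
      simp only [Function.update_of_ne hlj]; omega
  · intro l hl m hm hlm h0
    by_cases hlj : l = j
    · by_cases hmj : m = j
      · rw [hlj, hmj]
      · subst hlj
        simp only [Function.update_self, Function.update_of_ne hmj] at hlm
        exact absurd hlm.symm (hb.free m hm)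
    · by_cases hmj : m = j
      · subst hmj
        simp only [Function.update_self, Function.update_of_ne hlj] at hlm
        exact absurd hlm (hb.free l hl)
      · simp only [Function.update_of_ne hmj, Function.update_of_ne hlj] at hlm h0
        exact h.inj l hl m hm hlm h0
  · intro l hl
    by_cases hlj : l = j
    · subst hlj; simp
    · simpa [hlj] using h.pos l hl
  · intro l hl
    by_cases hlj : l = j
    · subst hlj; simpa using hb.price
    · simpa [hlj] using h.bound l hl

theorem sum_bid {j : ℕ} (hj : j < n) :
    ∑ l ∈ Finset.range n, Function.update p j (p j + 1) l = (∑ l ∈ Finset.range n, p l) + 1 := by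
  rw [Finset.sum_update_of_mem (Finset.mem_range.2 hj),
    ← Finset.sum_sdiff (Finset.singleton_subset_iff.2 (Finset.mem_range.2 hj)),
    Finset.sum_singleton]
  omega

theorem Inv.sum_le (h : Inv n C p o) : ∑ l ∈ Finset.range n, p l ≤ n * (n + 1) := by
  simpa using Finset.sum_le_card_nsmul (Finset.range n) p (n + 1)
    fun l hl => h.bound l (Finset.mem_range.1 hl)

/-- The auction is over. -/
def Finished (n : ℕ) (C : ℕ → ℕ → Prop) (p o : ℕ → ℕ) : Prop :=
  ∀ i < n, ∀ j < n, ¬ CanBid n C p o i j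

/-- Otherwise a cheapest partner of the free vertex `i` would have price at most `n`, and `i` could
still bid for it. -/
theorem Finished.lt_price (hf : Finished n C p o) {i : ℕ} (hi : i < n) (hfree : ∀ l < n, o l ≠ i + 1)
    {j : ℕ} (hj : j < n) (hij : C i j) : n < p j := by
  classical
  by_contra! hle
  obtain ⟨m, hm, hmin⟩ := Finset.exists_min_image ((Finset.range n).filter (C i)) p
    ⟨j, by simp [hj, hij]⟩
  simp only [Finset.mem_filter, Finset.mem_range] at hm hmin
  exact hf i hi m hm.1 ⟨hfree, fun l hl hil => hmin l ⟨hl, hil⟩, hm.2,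
    (hmin j ⟨hj, hij⟩).trans hle⟩

/-- The vertices that are removed for the price level `h`. -/
def Removed (n : ℕ) (C : ℕ → ℕ → Prop) (p : ℕ → ℕ) (h x : ℕ) : Prop :=
  h ≤ p x ∨ ∃ j < n, C x j ∧ p j < h

/-- The remaining vertices are pairwise unrelated. -/
theorem removed_or_removed (h : ℕ) {x y : ℕ} (hy : y < n) (hxy : C x y) :
    Removed n C p h x ∨ Removed n C p h y := by
  rcases lt_or_ge (p y) h with hp | hp
  · exact Or.inl (Or.inr ⟨y, hy, hxy, hp⟩)
  · exact Or.inr (Or.inl hp)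

open Classical in
/-- For a transitive relation, a set that meets all related pairs has at least the size of the
matching. -/
theorem Inv.card_owned_le (hI : Inv n C p o)
    (htr : ∀ x y z, C x y → C y z → C x z) {A : Finset ℕ}
    (hA : ∀ x y, C x y → x ∈ A ∨ y ∈ A) :
    ((Finset.range n).filter fun j => o j ≠ 0).card ≤ A.card := by
  -- Each matching edge `(o j - 1, j)` is charged to an endpoint in `A`: to `j` if `j` lies in `A`
  -- and is related from some `s` outside `A`, and to `o j - 1` otherwise. A vertex charged both as
  -- the right end of one edge and as the left end of another would, by transitivity, pass the
  -- property `U` on to the right end of the second edge, which would then have been charged there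
  -- instead.
  set U : ℕ → Prop := fun x => ∃ s, s ∉ A ∧ C s x with hU
  have hrel : ∀ j < n, o j ≠ 0 → C (o j - 1) j := fun j hj h0 => hI.rel j hj _ (by omega)
  have hmove : ∀ x y, C x y → x ∈ A ∧ U x → y ∈ A ∧ U y := by
    rintro x y hxy ⟨-, s, hs, hsx⟩
    have hsy := htr _ _ _ hsx hxy
    exact ⟨(hA s y hsy).resolve_left hs, s, hs, hsy⟩
  refine Finset.card_le_card_of_injOn (fun j => if j ∈ A ∧ U j then j else o j - 1) ?_ ?_
  · intro j hj
    simp only [Finset.coe_filter, Finset.mem_range, Set.mem_ofPred_eq] at hj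
    simp only [Finset.mem_coe]
    split_ifs with hjA
    · exact hjA.1
    · by_contra hi
      have hr := hrel j hj.1 hj.2
      exact hjA ⟨(hA _ _ hr).resolve_left hi, _, hi, hr⟩
  · intro j hj l hl hjl
    simp only [Finset.coe_filter, Finset.mem_range, Set.mem_ofPred_eq] at hj hl
    have h1 := hrel j hj.1 hj.2
    have h2 := hrel l hl.1 hl.2
    simp only at hjl
    split_ifs at hjl with hjA hlA hlA
    · exact hjl
    · rw [← hjl] at h2
      exact absurd (hmove _ _ h2 hjA) hlA
    · rw [hjl] at h1
      exact absurd (hmove _ _ h1 hlA) hjA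
    · exact hI.inj j hj.1 l hl.1 (by have := hj.2; have := hl.2; omega) hj.2

open Classical in
/-- At some price level no more vertices are removed than there are edges in the matching. -/
theorem Inv.exists_card_removed_le (hI : Inv n C p o) (hf : Finished n C p o) :
    ∃ h < n + 2, ((Finset.range n).filter (Removed n C p h)).card ≤
      ((Finset.range n).filter fun j => o j ≠ 0).card := by
  -- Pigeonhole: there are `n + 1` levels and at most `n` distinct prices.
  obtain ⟨h, hh, hhp⟩ : ∃ h ∈ Finset.Icc 1 (n + 1), h ∉ (Finset.range n).image p := by
    apply Finset.exists_mem_notMem_of_card_lt_card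
    refine lt_of_le_of_lt Finset.card_image_le ?_
    simp
  simp only [Finset.mem_Icc, Finset.mem_image, Finset.mem_range, not_exists, not_and] at hh hhp
  refine ⟨h, by omega, ?_⟩
  have hown : ∀ x < n, Removed n C p h x → ¬ h ≤ p x → ∃ j < n, o j = x + 1 := by
    rintro x hx (hr | ⟨j, hj, hxj, hp⟩) hn
    · exact absurd hr hn
    -- A free vertex has only partners of price above `n`, hence none below `h ≤ n + 1`.
    · by_contra! hfree
      have := hf.lt_price hx hfree hj hxj
      omega
  choose! m hm using hown
  -- By `slack`, what `x` owns costs at most one more than a partner cheaper than `h`, so at most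
  -- `h`; and no price equals `h`.
  have hcross : ∀ x < n, Removed n C p h x → ¬ h ≤ p x → p (m x) < h := by
    intro x hx hr hn
    obtain ⟨h1, h2⟩ := hm x hx hr hn
    obtain ⟨j, hj, hxj, hp⟩ := hr.resolve_left hn
    have h3 := hI.slack _ h1 x h2 j hj hxj
    have := hhp (m x) h1
    omega
  -- Expensive vertices are owned and are mapped to themselves; the others are mapped to what they
  -- own, which is cheaper than `h`. The two kinds of images are disjoint.
  refine Finset.card_le_card_of_injOn (fun x => if h ≤ p x then x else m x) ?_ ?_
  · intro x hx
    simp only [Finset.coe_filter, Finset.mem_range, Set.mem_ofPred_eq] at hx ⊢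
    split_ifs with hp
    · exact ⟨hx.1, hI.pos x hx.1 (by omega)⟩
    · obtain ⟨h1, h2⟩ := hm x hx.1 hx.2 hp
      exact ⟨h1, by omega⟩
  · intro x hx y hy hxy
    simp only [Finset.coe_filter, Finset.mem_range, Set.mem_ofPred_eq] at hx hy
    simp only at hxy
    split_ifs at hxy with h1 h2 h2
    · exact hxy
    · have := hcross y hy.1 hy.2 h2
      rw [← hxy] at this
      omega
    · have := hcross x hx.1 hx.2 h1
      rw [hxy] at this
      omega
    · have e1 := (hm x hx.1 hx.2 h1).2
      have e2 := (hm y hy.1 hy.2 h2).2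
      rw [hxy] at e1
      omega

end Auction

/-! ### Shortest paths -/

namespace ShortestPath

/-- Take detours through `c` into account. Negative entries stand for `∞`. -/
noncomputable def relax (D : ℕ → ℕ → ℝ) (c i j : ℕ) : ℝ :=
  if 0 ≤ D i c ∧ 0 ≤ D c j ∧ (D i j < 0 ∨ D i c + D c j < D i j) then D i c + D c j else D i j

/-- The triangle inequality for paths through `m`. -/
def Triangle (n : ℕ) (D : ℕ → ℕ → ℝ) (m : ℕ) : Prop :=
  ∀ i < n, ∀ j < n, 0 ≤ D i m → 0 ≤ D m j → 0 ≤ D i j ∧ D i j ≤ D i m + D m j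

variable {n : ℕ} {D : ℕ → ℕ → ℝ} {c : ℕ}

theorem relax_le {i j : ℕ} (h : 0 ≤ D i j) : 0 ≤ relax D c i j ∧ relax D c i j ≤ D i j := by
  unfold relax
  split_ifs with h'
  · exact ⟨add_nonneg h'.1 h'.2.1, (h'.2.2.resolve_left (not_lt.2 h)).le⟩
  · exact ⟨h, le_rfl⟩

theorem relax_le_detour {i j : ℕ} (h1 : 0 ≤ D i c) (h2 : 0 ≤ D c j) :
    0 ≤ relax D c i j ∧ relax D c i j ≤ D i c + D c j := by
  unfold relax
  split_ifs with h'
  · exact ⟨add_nonneg h1 h2, le_rfl⟩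
  · simp only [h1, h2, true_and, not_or, not_lt] at h'
    exact h'

theorem relax_cases {i j : ℕ} : relax D c i j = D i j ∨
    0 ≤ D i c ∧ 0 ≤ D c j ∧ relax D c i j = D i c + D c j := by
  unfold relax
  split_ifs with h'
  · exact Or.inr ⟨h'.1, h'.2.1, rfl⟩
  · exact Or.inl rfl

/-- The cases are whether each of the two legs takes the detour through `c`. If both do, the closed
walk from `c` to `m` and back is dropped. -/
theorem triangle_relax_of_triangle (hc : c < n) {m : ℕ} (h : Triangle n D m) :
    Triangle n (relax D c) m := by
  have combine : ∀ i j x, 0 ≤ D i j → D i j ≤ x →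
      0 ≤ relax D c i j ∧ relax D c i j ≤ x := fun i j x h1 h2 =>
    ⟨(relax_le h1).1, (relax_le h1).2.trans h2⟩
  intro i hi j hj h1 h2
  rcases relax_cases (D := D) (c := c) (i := i) (j := m) with e1 | ⟨a1, b1, e1⟩ <;>
  rcases relax_cases (D := D) (c := c) (i := m) (j := j) with e2 | ⟨a2, b2, e2⟩ <;>
  rw [e1] at h1 ⊢ <;> rw [e2] at h2 ⊢
  · obtain ⟨h3, h4⟩ := h i hi j hj h1 h2
    exact combine _ _ _ h3 h4
  · obtain ⟨h3, h4⟩ := h i hi c hc h1 a2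
    obtain ⟨h5, h6⟩ := relax_le_detour (D := D) h3 b2
    exact ⟨h5, by linarith⟩
  · obtain ⟨h3, h4⟩ := h c hc j hj b1 h2
    obtain ⟨h5, h6⟩ := relax_le_detour (D := D) a1 h3
    exact ⟨h5, by linarith⟩
  · obtain ⟨h5, h6⟩ := relax_le_detour (D := D) a1 b2
    exact ⟨h5, by linarith⟩

theorem triangle_relax_self (h0 : D c c = 0) : Triangle n (relax D c) c := by
  intro i hi j hj h1 h2
  have e1 : relax D c i c = D i c := by
    rcases relax_cases (D := D) (c := c) (i := i) (j := c) with e | ⟨_, _, e⟩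
    · exact e
    · rw [e, h0, add_zero]
  have e2 : relax D c c j = D c j := by
    rcases relax_cases (D := D) (c := c) (i := c) (j := j) with e | ⟨_, _, e⟩
    · exact e
    · rw [e, h0, zero_add]
  rw [e1] at h1 ⊢
  rw [e2] at h2 ⊢
  exact relax_le_detour h1 h2

theorem relax_self {i : ℕ} (h0 : D i i = 0) : relax D c i i = 0 := by
  obtain ⟨h1, h2⟩ := relax_le (c := c) h0.ge
  linarith

end ShortestPath

/-! ### Distances, conflicts and McShane extensions -/

namespace PartiallyLabeledGraph

variable {n : ℕ} (G : PartiallyLabeledGraph (Fin n))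

theorem abs_sub_le_gradNorm (v : Fin n → ℝ) {x y : Fin n} (h : G.graph.Adj x y) :
    |v x - v y| ≤ G.gradNorm v * G.len x y := by
  classical
  have h1 : |G.grad v x y| ≤ G.gradNorm v :=
    le_ciSup (f := fun d : G.graph.Dart => |G.grad v d.fst d.snd|)
      (Set.finite_range _).bddAbove ⟨(x, y), h⟩
  have hpos := G.len_pos x y h
  rw [grad, abs_div, abs_of_pos hpos, div_le_iff₀ hpos] at h1
  exact h1

theorem gradNorm_nonneg (v : Fin n → ℝ) : 0 ≤ G.gradNorm v :=
  Real.iSup_nonneg fun _ => abs_nonneg _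

theorem gradNorm_le {v : Fin n → ℝ} {α : ℝ} (hα : 0 ≤ α)
    (h : ∀ x y, G.graph.Adj x y → |v x - v y| ≤ α * G.len x y) : G.gradNorm v ≤ α := by
  refine Real.iSup_le (fun d => ?_) hα
  have hpos := G.len_pos _ _ d.adj
  rw [grad, abs_div, abs_of_pos hpos, div_le_iff₀ hpos]
  exact h _ _ d.adj

/-- `D` is a matrix of distances: it obeys the triangle inequality, it is bounded by the edge
lengths, and functions that are Lipschitz along the edges are Lipschitz with respect to `D`.
Negative entries stand for `∞`. The triangle inequality is required for paths through the vertices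
below `c` only. -/
structure IsDist (c : ℕ) (D : ℕ → ℕ → ℝ) : Prop where
  triangle : ∀ m < c, ShortestPath.Triangle n D m
  self : ∀ i < n, D i i = 0
  edge : ∀ x y : Fin n, G.graph.Adj x y → 0 ≤ D x y ∧ D x y ≤ G.len x y
  lipschitz : ∀ (v : Fin n → ℝ) (α : ℝ),
    (∀ x y, G.graph.Adj x y → |v x - v y| ≤ α * G.len x y) →
      ∀ i j : Fin n, 0 ≤ D i j → |v i - v j| ≤ α * D i j

/-- The set `T` and the function `L` describe the terminals and their labels. -/
structure IsLabeling (T : ℕ → Prop) (L : ℕ → ℝ) : Prop where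
  lt : ∀ i, T i → i < n
  label : ∀ x : Fin n, T x → G.label x = some (L x)
  none : ∀ x : Fin n, ¬ T x → G.label x = none

/-- The labels of the terminals `x` and `y` force a gradient larger than `α` between `x` and `y`,
the label of `y` being the larger one. -/
def Conflict (T : ℕ → Prop) (L : ℕ → ℝ) (D : ℕ → ℕ → ℝ) (α : ℝ) (x y : ℕ) : Prop :=
  T x ∧ T y ∧ 0 ≤ D x y ∧ α * D x y < L y - L x

/-- `r` is the value at `x` of the largest extension with gradient `α` of the labels on `S`. -/
def IsExtensionAt (n : ℕ) (S : ℕ → Prop) (L : ℕ → ℝ) (D : ℕ → ℕ → ℝ) (α : ℝ) (x : ℕ) (r : ℝ) :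
    Prop :=
  (∀ y < n, S y → 0 ≤ D y x → r ≤ L y + α * D y x) ∧
    ((∃ y < n, S y ∧ 0 ≤ D y x ∧ r = L y + α * D y x) ∨
      (∀ y < n, S y → ¬ 0 ≤ D y x) ∧ r = 0)

/-- `u` is the largest extension with gradient `α` of the labels on `S`. -/
def IsExtension (n : ℕ) (S : ℕ → Prop) (L : ℕ → ℝ) (D : ℕ → ℕ → ℝ) (α : ℝ) (u : ℕ → ℝ) : Prop :=
  ∀ x < n, IsExtensionAt n S L D α x (u x)

variable {G} {T : ℕ → Prop} {L : ℕ → ℝ} {D : ℕ → ℕ → ℝ} {α : ℝ} {S : ℕ → Prop} {u : ℕ → ℝ} {k : ℕ}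

theorem IsDist.relax {c : ℕ} (h : G.IsDist c D) (hc : c < n) {D' : ℕ → ℕ → ℝ}
    (hD' : ∀ x < n, ∀ y < n, D' x y = ShortestPath.relax D c x y) : G.IsDist (c + 1) D' := by
  refine ⟨fun m hm i hi j hj => ?_, fun i hi => ?_, fun x y hxy => ?_, fun v α hv i j => ?_⟩
  · rw [hD' i hi m (by omega), hD' m (by omega) j hj, hD' i hi j hj]
    rcases Nat.lt_succ_iff_lt_or_eq.1 hm with hm | rfl
    · exact ShortestPath.triangle_relax_of_triangle hc (h.triangle m hm) i hi j hj
    · exact ShortestPath.triangle_relax_self (h.self m hc) i hi j hj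
  · rw [hD' i hi i hi]
    exact ShortestPath.relax_self (h.self i hi)
  · rw [hD' x x.2 y y.2]
    obtain ⟨h1, h2⟩ := h.edge x y hxy
    obtain ⟨h3, h4⟩ := ShortestPath.relax_le (c := c) h1
    exact ⟨h3, h4.trans h2⟩
  · rw [hD' i i.2 j j.2]
    rcases ShortestPath.relax_cases (D := D) (c := c) (i := i) (j := j) with e | ⟨h1, h2, e⟩
    · rw [e]
      exact h.lipschitz v α hv i j
    · rw [e, mul_add]
      intro _
      exact (abs_sub_le _ (v ⟨c, hc⟩) _).trans
        (add_le_add (h.lipschitz v α hv i ⟨c, hc⟩ h1) (h.lipschitz v α hv ⟨c, hc⟩ j h2))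

/-- The label differences add up, while the distance grows at most additively. -/
theorem Conflict.trans (hD : G.IsDist n D) (hT : G.IsLabeling T L) (hα : 0 ≤ α) {x y z : ℕ}
    (h1 : Conflict T L D α x y) (h2 : Conflict T L D α y z) : Conflict T L D α x z := by
  obtain ⟨hx, hy, h3, h4⟩ := h1
  obtain ⟨-, hz, h5, h6⟩ := h2
  obtain ⟨h7, h8⟩ := hD.triangle y (hT.lt y hy) x (hT.lt x hx) z (hT.lt z hz) h3 h5
  refine ⟨hx, hz, h7, ?_⟩
  have := mul_le_mul_of_nonneg_left h8 hα
  rw [mul_add] at this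
  linarith

/-- A kept vertex that reaches `x` also reaches its neighbour `y`, at an extra distance of at most
the edge length. If none reaches `x`, none reaches `y`, and both values are the default `0`. -/
theorem IsExtension.le_add (hu : IsExtension n S L D α u) (hD : G.IsDist n D) (hα : 0 ≤ α)
    {x y : Fin n} (h : G.graph.Adj x y) : u y ≤ u x + α * G.len x y := by
  have hmul : 0 ≤ α * G.len x y := mul_nonneg hα (G.len_pos x y h).le
  obtain ⟨h1, h2⟩ := hD.edge x y h
  have hlen := mul_le_mul_of_nonneg_left h2 hα
  rcases (hu x x.2).2 with ⟨s, hs, hSs, hsx, e⟩ | ⟨hno, e⟩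
  · obtain ⟨h3, h4⟩ := hD.triangle x x.2 s hs y y.2 hsx h1
    have h5 := (hu y y.2).1 s hs hSs h3
    have h6 := mul_le_mul_of_nonneg_left h4 hα
    rw [mul_add] at h6
    linarith
  · rcases (hu y y.2).2 with ⟨s, hs, hSs, hsy, -⟩ | ⟨-, e'⟩
    · exact absurd (hD.triangle y y.2 s hs x x.2 hsy (hD.edge y x h.symm).1).1 (hno s hs hSs)
    · linarith

theorem IsExtension.gradNorm_le (hu : IsExtension n S L D α u) (hD : G.IsDist n D) (hα : 0 ≤ α) :
    G.gradNorm (fun i => u i) ≤ α := by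
  refine G.gradNorm_le hα fun x y h => abs_sub_le_iff.2 ⟨?_, ?_⟩
  · have := hu.le_add hD hα h.symm
    rw [G.len_symm y x h.symm] at this
    linarith
  · have := hu.le_add hD hα h
    linarith

-- The extension agrees with the labels on `S`: the bound from `x` itself gives `u x ≤ L x` since `D
-- x x = 0`, and the absence of conflicts gives the converse at the minimising vertex.
open Classical in
theorem IsExtension.mem_feasible (hu : IsExtension n S L D α u) (hD : G.IsDist n D)
    (hT : G.IsLabeling T L) (hST : ∀ x, S x → T x)
    (hS : ∀ x y, S x → S y → ¬ Conflict T L D α x y)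
    (hk : ((Finset.range n).filter fun x => T x ∧ ¬ S x).card ≤ k) :
    (fun i : Fin n => u i) ∈ G.feasible k := by
  have heq : ∀ x < n, S x → u x = L x := by
    intro x hx hSx
    have h0 := hD.self x hx
    obtain ⟨h1, ⟨y, hy, hSy, hyx, e⟩ | ⟨hno, -⟩⟩ := hu x hx
    · have h2 := h1 x hx hSx h0.ge
      rw [h0, mul_zero, add_zero] at h2
      have h3 : ¬ α * D y x < L x - L y := fun h =>
        hS y x hSy hSx ⟨hST y hSy, hST x hSx, hyx, h⟩
      linarith
    · exact absurd h0.ge (hno x hx hSx)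
  refine le_trans ?_ hk
  rw [labelDist, ← Set.ncard_coe_finset]
  refine Set.ncard_le_ncard_of_injOn (fun x : Fin n => (x : ℕ)) ?_ Fin.val_injective.injOn
    (Finset.finite_toSet _)
  rintro x ⟨hx, hxu⟩
  have hTx : T x := by
    by_contra h
    exact hx (hT.none x h)
  simp only [Finset.coe_filter, Finset.mem_range, Set.mem_ofPred_eq]
  refine ⟨x.2, hTx, fun hSx => hxu ?_⟩
  rw [hT.label x hTx, heq x x.2 hSx]

/-- Among the quotients of label differences and distances there is one that bounds the gradients
forced by the labels that a given feasible assignment keeps. -/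
theorem exists_quotient (hn : 0 < n) (hD : G.IsDist n D) (hT : G.IsLabeling T L) {v : Fin n → ℝ}
    (hv : v ∈ G.feasible k) :
    ∃ s < n, ∃ t < n, 0 ≤ (L t - L s) / D s t ∧ (L t - L s) / D s t ≤ G.gradNorm v ∧
      ∃ A : Finset ℕ, A.card ≤ k ∧
        ∀ x y, Conflict T L D ((L t - L s) / D s t) x y → x ∈ A ∨ y ∈ A := by
  classical
  set R : ℕ × ℕ → ℝ := fun q => (L q.2 - L q.1) / D q.1 q.2 with hR
  set K : ℕ → Prop := fun x => T x ∧ ∀ h : x < n, v ⟨x, h⟩ = L x with hK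
  -- Pairs kept by `v` at finite distance, together with the diagonal. The diagonal contributes the
  -- quotient `0`, so that the maximum exists and is nonnegative even if `v` keeps no label.
  set F := (Finset.range n ×ˢ Finset.range n).filter fun q : ℕ × ℕ =>
    q.1 = q.2 ∨ K q.1 ∧ K q.2 ∧ 0 ≤ D q.1 q.2 with hF
  have hkey : ∀ x y, K x → K y → 0 ≤ D x y → L y - L x ≤ G.gradNorm v * D x y := by
    intro x y hx hy hxy
    have hxn := hT.lt x hx.1
    have hyn := hT.lt y hy.1
    have h1 := hD.lipschitz v (G.gradNorm v) (fun a b h => G.abs_sub_le_gradNorm v h)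
      ⟨x, hxn⟩ ⟨y, hyn⟩ hxy
    rw [hx.2 hxn, hy.2 hyn, abs_sub_comm] at h1
    exact (le_abs_self _).trans h1
  have h00 : ((0, 0) : ℕ × ℕ) ∈ F := by simp [hF, hn]
  obtain ⟨⟨s, t⟩, hst, hmax⟩ := F.exists_max_image R ⟨_, h00⟩
  have h0 : 0 ≤ R (s, t) := by
    have := hmax _ h00
    simpa [hR] using this
  simp only [hF, Finset.mem_filter, Finset.mem_product, Finset.mem_range] at hst hmax
  -- The cover consists of the terminals that `v` gives up: two kept terminals cannot conflict at
  -- the maximal quotient.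
  refine ⟨s, hst.1.1, t, hst.1.2, h0, ?_,
    (Finset.univ.filter fun x : Fin n => x ∈ G.terminals ∧ G.label x ≠ some (v x)).map
      Fin.valEmbedding, ?_, ?_⟩
  · rcases hst.2 with rfl | ⟨hs, ht, hd⟩
    · simpa using G.gradNorm_nonneg v
    · exact div_le_of_le_mul₀ hd (G.gradNorm_nonneg v) (hkey s t hs ht hd)
  · rw [Finset.card_map, ← Set.ncard_coe_finset]
    simpa [feasible, labelDist] using hv
  · rintro x y ⟨hx, hy, hxy, hlt⟩
    have hmem : ∀ z, T z → ¬ K z → z ∈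
        (Finset.univ.filter fun x : Fin n => x ∈ G.terminals ∧ G.label x ≠ some (v x)).map
          Fin.valEmbedding := by
      intro z hz hKz
      have hzn := hT.lt z hz
      simp only [hK, hz, hzn, true_and, forall_true_left] at hKz
      have hl := hT.label ⟨z, hzn⟩ hz
      refine Finset.mem_map.2 ⟨⟨z, hzn⟩, Finset.mem_filter.2 ⟨Finset.mem_univ _, ?_, ?_⟩, rfl⟩
      · change G.label _ ≠ Option.none
        simp [hl]
      · rw [hl]
        simpa using Ne.symm hKz
    by_contra! hne
    have hKx : K x := by
      by_contra h
      exact hne.1 (hmem x hx h)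
    have hKy : K y := by
      by_contra h
      exact hne.2 (hmem y hy h)
    have h1 := hmax (x, y) ⟨⟨hT.lt x hx, hT.lt y hy⟩, Or.inr ⟨hKx, hKy, hxy⟩⟩
    -- At distance `0` the quotient carries no information, but there the Lipschitz bound already
    -- forces `L y ≤ L x`.
    rcases hxy.eq_or_lt with h2 | h2
    · have := hkey x y hKx hKy hxy
      rw [← h2, mul_zero] at this hlt
      linarith
    · have h3 : R (x, y) * D x y ≤ R (s, t) * D x y := mul_le_mul_of_nonneg_right h1 hxy
      have h4 : R (x, y) * D x y = L y - L x := div_mul_cancel₀ _ h2.ne'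
      rw [h4] at h3
      exact absurd hlt (not_lt.2 h3)

end PartiallyLabeledGraph

/-! ### Derived tests, matrix loops and the distance computation -/

namespace RealRAM

open PartiallyLabeledGraph

/-- Equality of natural numbers. -/
def Test.natEq (e f : NatExp) : Test := .conj (.natLe e f) (.natLe f e)

/-- Strict inequality of natural numbers. -/
def Test.natLt (e f : NatExp) : Test := .neg (.natLe f e)

/-- Strict inequality of real numbers. -/
def Test.realLt (e f : RealExp) : Test := .neg (.realLe f e)

/-- Disjunction. -/
def Test.or (b c : Test) : Test := .neg (.conj (.neg b) (.neg c))

@[simp] theorem Test.holds_natEq {σ : State} {e f : NatExp} :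
    (Test.natEq e f).Holds σ ↔ e.eval σ = f.eval σ := le_antisymm_iff.symm

@[simp] theorem Test.holds_natLt {σ : State} {e f : NatExp} :
    (Test.natLt e f).Holds σ ↔ e.eval σ < f.eval σ := not_le

@[simp] theorem Test.holds_realLt {σ : State} {e f : RealExp} :
    (Test.realLt e f).Holds σ ↔ e.eval σ < f.eval σ := not_le

@[simp] theorem Test.holds_or {σ : State} {b c : Test} :
    (Test.or b c).Holds σ ↔ b.Holds σ ∨ c.Holds σ := by
  simp only [Test.or, Test.Holds]; tauto

@[simp] theorem Test.holds_conj {σ : State} {b c : Test} :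
    (Test.conj b c).Holds σ ↔ b.Holds σ ∧ c.Holds σ := Iff.rfl

@[simp] theorem Test.holds_neg {σ : State} {b : Test} : (Test.neg b).Holds σ ↔ ¬ b.Holds σ :=
  Iff.rfl

@[simp] theorem Test.holds_natLe {σ : State} {e f : NatExp} :
    (Test.natLe e f).Holds σ ↔ e.eval σ ≤ f.eval σ := Iff.rfl

@[simp] theorem Test.holds_realLe {σ : State} {e f : RealExp} :
    (Test.realLe e f).Holds σ ↔ e.eval σ ≤ f.eval σ := Iff.rfl

/-- The cell `a[0][0]`. -/
def natCell (a : ℕ) : NatExp := .get a (.const 0) (.const 0)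

/-- The cell `a[x][0]`. -/
def natAt (a : ℕ) (x : NatExp) : NatExp := .get a x (.const 0)

/-- The real cell `a[0][0]`. -/
def realCell (a : ℕ) : RealExp := .get a (.const 0) (.const 0)

/-- The real cell `a[x][0]`. -/
def realAt (a : ℕ) (x : NatExp) : RealExp := .get a x (.const 0)

namespace ForProgram

theorem Frame.of_rep {P : ForProgram} {c : ℕ} {σ τ : State} (h : (rep c P).Frame σ τ) :
    P.Frame σ τ := ⟨h.nat, h.real⟩

/-- Two nested loops that compute the entries of a matrix. -/
theorem den_fill {P : ForProgram} {n a : ℕ} {ρ : List ℕ} {σ : State} {val : ℕ → ℕ → ℝ}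
    (hn : σ.nat 0 0 0 = n)
    (h : ∀ i < n, ∀ j < n, ∀ τ, P.Frame σ τ → ∀ x y, (P.den (ρ ++ [i] ++ [j]) τ).real a x y =
      if x = i ∧ y = j then val i j else τ.real a x y) :
    ∀ x < n, ∀ y < n, ((rep 0 (rep 0 P)).den ρ σ).real a x y = val x y := by
  have := den_rep_induct (P := rep 0 P) (c := 0) (ρ := ρ)
    (fun m τ => ∀ x < m, ∀ y < n, τ.real a x y = val x y) hn (by simp) ?_
  · exact this
  intro i τ hi hτ ih
  have key := den_rep_induct (P := P) (c := 0) (ρ := ρ ++ [i]) (σ := τ)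
    (fun m υ => (∀ x < i, ∀ y < n, υ.real a x y = val x y) ∧ ∀ y < m, υ.real a i y = val i y)
    (hτ.size.trans hn) ⟨ih, by simp⟩ ?_
  · intro x hx y hy
    rcases Nat.lt_succ_iff_lt_or_eq.1 hx with hx | rfl
    exacts [key.1 x hx y hy, key.2 y hy]
  rintro j υ hj hυ ⟨h1, h2⟩
  have h3 := h i hi j hj υ (hτ.of_rep.trans hυ)
  refine ⟨fun x hx y hy => ?_, fun y hy => ?_⟩
  · rw [h3, if_neg (by omega), h1 x hx y hy]
  · rw [h3]
    split_ifs with hyj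
    · rw [hyj.2]
    · exact h2 y (by omega)

/-! ### Distances -/

/-- Enter the edge lengths into the matrix of distances. -/
def initDist : ForProgram :=
  rep 0 (rep 0 (cond (.natEq (ctr 0) (ctr 1)) (setReal 1 (ctr 0) (ctr 1) (.const 0))
    (cond (.natEq (.get 1 (ctr 0) (ctr 1)) (.const 1))
      (setReal 1 (ctr 0) (ctr 1) (.get 0 (ctr 0) (ctr 1)))
      (setReal 1 (ctr 0) (ctr 1) (.const (-1))))))

/-- One round of the algorithm of Floyd and Warshall, with the result in the real array `4`. -/
def relaxDist : ForProgram :=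
  rep 0 (rep 0 (cond
    (.conj (.realLe (.const 0) (.get 3 (ctr 1) (ctr 0)))
      (.conj (.realLe (.const 0) (.get 3 (ctr 0) (ctr 2)))
        (.or (.realLt (.get 3 (ctr 1) (ctr 2)) (.const 0))
          (.realLt (.add (.get 3 (ctr 1) (ctr 0)) (.get 3 (ctr 0) (ctr 2)))
            (.get 3 (ctr 1) (ctr 2))))))
    (setReal 2 (ctr 1) (ctr 2) (.add (.get 3 (ctr 1) (ctr 0)) (.get 3 (ctr 0) (ctr 2))))
    (setReal 2 (ctr 1) (ctr 2) (.get 3 (ctr 1) (ctr 2)))))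

/-- Copy the real array `4` into the real array `3`. -/
def copyDist : ForProgram :=
  rep 0 (rep 0 (setReal 1 (ctr 1) (ctr 2) (.get 4 (ctr 1) (ctr 2))))

/-- The algorithm of Floyd and Warshall. -/
def distances : ForProgram := seq initDist (rep 0 (seq relaxDist copyDist))

theorem isDist_initDist {n k : ℕ} (G : PartiallyLabeledGraph (Fin n)) :
    G.IsDist 0 ((initDist.den [] (input k G)).real 3) := by
  classical
  have hfill : ∀ x < n, ∀ y < n, (initDist.den [] (input k G)).real 3 x y =
      if x = y then 0 else if (input k G).nat 1 x y = 1 then (input k G).real 0 x y else -1 := by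
    refine den_fill (by simp [input]) ?_
    intro i hi j hj τ hτ x y
    have h1 : τ.nat 1 = (input k G).nat 1 := hτ.nat 1 (by simp [natWrites])
    have h2 : τ.real 0 = (input k G).real 0 := hτ.real 0 (by simp [realWrites])
    rw [← h1, ← h2]
    simp only [den, Test.holds_natEq, NatExp.eval, RealExp.eval, ctr, State.withCounters]
    by_cases hij : i = j
    · simp [hij, State.setReal]
    · by_cases ha : τ.nat 1 i j = 1
      · simp [hij, ha, State.setReal]
      · simp [hij, ha, State.setReal]
  have hadj : ∀ x y : Fin n, G.graph.Adj x y → (initDist.den [] (input k G)).real 3 x y =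
      G.len x y := by
    intro x y hxy
    have hne : (x : ℕ) ≠ y := fun h => hxy.ne (Fin.ext h)
    rw [hfill x x.2 y y.2, if_neg hne, if_pos]
    · simp [input, hxy]
    · simpa [input] using ⟨x, rfl, y, rfl, hxy⟩
  have hnadj : ∀ x y : Fin n, x ≠ y → ¬ G.graph.Adj x y →
      (initDist.den [] (input k G)).real 3 x y = -1 := by
    intro x y hne hxy
    rw [hfill x x.2 y y.2, if_neg (fun h => hne (Fin.ext h)), if_neg]
    have : ∀ a : Fin n, (a : ℕ) = x → ∀ b : Fin n, (b : ℕ) = y → ¬ G.graph.Adj a b := by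
      intro a ha b hb
      rwa [Fin.ext ha, Fin.ext hb]
    simpa [input] using this
  refine ⟨fun m hm => absurd hm (by omega), fun i hi => ?_, fun x y hxy => ?_,
    fun v α hv i j hij => ?_⟩
  · rw [hfill i hi i hi, if_pos rfl]
  · rw [hadj x y hxy]
    exact ⟨(G.len_pos x y hxy).le, le_rfl⟩
  · by_cases hne : i = j
    · subst hne
      rw [hfill i i.2 i i.2, if_pos rfl]
      simp
    · by_cases hadj' : G.graph.Adj i j
      · rw [hadj i j hadj']
        exact hv i j hadj'
      · rw [hnadj i j hne hadj'] at hij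
        norm_num at hij

/-- The round writes to a separate array, so every entry it reads belongs to the matrix before the
round. -/
theorem real_relaxDist {n c : ℕ} {σ : State} (hn : σ.nat 0 0 0 = n) :
    ∀ x < n, ∀ y < n, (relaxDist.den [c] σ).real 4 x y =
      ShortestPath.relax (σ.real 3) c x y := by
  classical
  refine den_fill hn ?_
  intro i hi j hj τ hτ x y
  have h1 : τ.real 3 = σ.real 3 := hτ.real 3 (by simp [realWrites])
  rw [← h1]
  simp only [den, Test.holds_conj, Test.holds_or, Test.holds_realLe, Test.holds_realLt,
    NatExp.eval, RealExp.eval, ctr, State.withCounters, ShortestPath.relax]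
  simp only [List.cons_append, List.nil_append, List.getD_cons_zero, List.getD_cons_succ, if_true,
    Rat.cast_zero]
  split_ifs <;> simp_all [State.setReal]

theorem real_copyDist {n c : ℕ} {σ : State} (hn : σ.nat 0 0 0 = n) :
    ∀ x < n, ∀ y < n, (copyDist.den [c] σ).real 3 x y = σ.real 4 x y := by
  refine den_fill hn ?_
  intro i hi j hj τ hτ x y
  have h1 : τ.real 4 = σ.real 4 := hτ.real 4 (by simp [realWrites])
  rw [← h1]
  simp [den, NatExp.eval, RealExp.eval, ctr, State.withCounters, State.setReal]

theorem isDist_distances {n k : ℕ} (G : PartiallyLabeledGraph (Fin n)) :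
    G.IsDist n ((distances.den [] (input k G)).real 3) := by
  have h0 : (input k G).nat 0 0 0 = n := by simp [input]
  refine den_rep_induct (P := seq relaxDist copyDist) (c := 0) (n := n) (ρ := [])
    (σ := initDist.den [] (input k G))
    (fun c τ => G.IsDist c (τ.real 3)) ((den_size _ _ _).trans h0) (isDist_initDist G) ?_
  intro c τ hc hτ ih
  have hn : τ.nat 0 0 0 = n := hτ.size.trans ((den_size _ _ _).trans h0)
  refine ih.relax hc fun x hx y hy => ?_
  simp only [den, List.nil_append]
  rw [real_copyDist ((den_size _ _ _).trans hn) x hx y hy, real_relaxDist hn x hx y hy]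

end ForProgram

end RealRAM

/-! ### The auction on the machine -/

namespace RealRAM

open PartiallyLabeledGraph Auction

/-- The vertex `x` is marked as a terminal. -/
def State.Terminal (σ : State) (x : ℕ) : Prop := σ.nat 2 x 0 = 1

/-- The label of `x`. -/
def State.labels (σ : State) (x : ℕ) : ℝ := σ.real 1 x 0

/-- The conflicts for the gradient in the real cell `5[0][0]`. -/
def State.Conf (σ : State) : ℕ → ℕ → Prop :=
  Conflict σ.Terminal σ.labels (σ.real 3) (σ.real 5 0 0)

/-- The prices in the auction. -/
def State.price (σ : State) (x : ℕ) : ℕ := σ.nat 5 x 0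

/-- The owners in the auction. -/
def State.owner (σ : State) (x : ℕ) : ℕ := σ.nat 6 x 0

/-- Test for a conflict. -/
def Test.conf (x y : NatExp) : Test :=
  .conj (.natEq (natAt 2 x) (.const 1)) (.conj (.natEq (natAt 2 y) (.const 1))
    (.conj (.realLe (.const 0) (.get 3 x y))
      (.realLt (.mul (realCell 5) (.get 3 x y)) (.sub (realAt 1 y) (realAt 1 x)))))

@[simp] theorem Test.holds_conf {ρ : List ℕ} {σ : State} {x y : NatExp} :
    (Test.conf x y).Holds (σ.withCounters ρ) ↔
      σ.Conf (x.eval (σ.withCounters ρ)) (y.eval (σ.withCounters ρ)) := by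
  simp [Test.conf, State.Conf, Conflict, State.Terminal, State.labels, natAt, realAt, realCell,
    NatExp.eval, RealExp.eval, State.withCounters]

theorem State.Conf.congr {σ τ : State} (h2 : τ.nat 2 = σ.nat 2) (h1 : τ.real 1 = σ.real 1)
    (h3 : τ.real 3 = σ.real 3) (h5 : τ.real 5 = σ.real 5) : τ.Conf = σ.Conf := by
  have e1 : τ.Terminal = σ.Terminal := by funext x; rw [State.Terminal, h2]; rfl
  have e2 : τ.labels = σ.labels := by funext x; rw [State.labels, h1]; rfl
  rw [State.Conf, State.Conf, e1, e2, h3, h5]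

@[simp] theorem eval_ctr (ρ : List ℕ) (d : ℕ) (σ : State) :
    (ctr d).eval (σ.withCounters ρ) = ρ.getD d 0 := by
  simp [ctr, NatExp.eval, State.withCounters]

@[simp] theorem eval_const (c : ℕ) (σ : State) : (NatExp.const c).eval σ = c := rfl

@[simp] theorem eval_add (e f : NatExp) (σ : State) : (e.add f).eval σ = e.eval σ + f.eval σ := rfl

@[simp] theorem eval_natAt_price (ρ : List ℕ) (σ : State) (x : NatExp) :
    (natAt 5 x).eval (σ.withCounters ρ) = σ.price (x.eval (σ.withCounters ρ)) := by
  simp [natAt, NatExp.eval, State.withCounters, State.price]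

@[simp] theorem eval_natAt_owner (ρ : List ℕ) (σ : State) (x : NatExp) :
    (natAt 6 x).eval (σ.withCounters ρ) = σ.owner (x.eval (σ.withCounters ρ)) := by
  simp [natAt, NatExp.eval, State.withCounters, State.owner]

@[simp] theorem eval_natCell_flag (ρ : List ℕ) (σ : State) :
    (natCell 4).eval (σ.withCounters ρ) = σ.nat 4 0 0 := by
  simp [natCell, NatExp.eval, State.withCounters]

@[simp] theorem eval_natCell_size (ρ : List ℕ) (σ : State) :
    (natCell 0).eval (σ.withCounters ρ) = σ.nat 0 0 0 := by
  simp [natCell, NatExp.eval, State.withCounters]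

theorem State.price_congr {σ τ : State} (h : τ.nat 5 = σ.nat 5) : τ.price = σ.price := by
  funext x; rw [State.price, h]; rfl

theorem State.owner_congr {σ τ : State} (h : τ.nat 6 = σ.nat 6) : τ.owner = σ.owner := by
  funext x; rw [State.owner, h]; rfl

namespace ForProgram

/-- Find out whether the test fails for all values of the next loop counter; the result is the
natural number cell `4[0][0]`. -/
def scan (b : Test) : ForProgram :=
  seq (setNat 0 (.const 0) (.const 0) (.const 1))
    (rep 0 (cond b (setNat 0 (.const 0) (.const 0) (.const 0)) skip))

theorem natWrites_scan (b : Test) : (scan b).natWrites = [4, 4] := rfl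

theorem realWrites_scan (b : Test) : (scan b).realWrites = [] := rfl

/-- The hypothesis on `b` covers all states that differ in the flag cell only, since the flag may
change during the scan. -/
theorem den_scan {b : Test} {B : ℕ → Prop} {n : ℕ} {ρ : List ℕ} {σ : State}
    (hn : σ.nat 0 0 0 = n)
    (hb : ∀ l < n, ∀ τ, (scan b).Frame σ τ → (b.Holds (τ.withCounters (ρ ++ [l])) ↔ B l)) :
    ((scan b).den ρ σ).nat 4 0 0 = 1 ↔ ∀ l < n, ¬ B l := by
  classical
  set σ' := (setNat 0 (.const 0) (.const 0) (.const 1)).den ρ σ with hσ'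
  have hσ : (scan b).Frame σ σ' := by
    refine ⟨fun a ha => (frame_den _ _ _).nat a ?_, fun a ha => (frame_den _ _ _).real a ?_⟩
    · simp only [natWrites_scan, natWrites] at ha ⊢; simpa using ha
    · simp [realWrites]
  refine den_rep_induct (c := 0) (n := n) (ρ := ρ) (σ := σ')
    (P := cond b (setNat 0 (.const 0) (.const 0) (.const 0)) skip)
    (fun m τ => τ.nat 4 0 0 = 1 ↔ ∀ l < m, ¬ B l) (hσ.size.trans hn) ?_ ?_
  · simp [hσ', den, NatExp.eval, State.setNat]
  · intro i τ hi hτ ih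
    have hτ' : (scan b).Frame σ τ := by
      refine hσ.trans ⟨fun a ha => hτ.nat a ?_, fun a ha => hτ.real a ?_⟩
      · simp only [natWrites_scan, natWrites] at ha ⊢; simpa using ha
      · simp [realWrites]
    have hbi := hb i hi τ hτ'
    by_cases h : B i
    · simp only [den, hbi.2 h, if_true]
      simp only [State.setNat, eval_const, and_self, if_true, zero_ne_one, false_iff]
      exact fun hall => hall i (by omega) h
    · have h' : ¬ b.Holds (τ.withCounters (ρ ++ [i])) := fun hh => h (hbi.1 hh)
      simp only [den, h', if_false, ih]
      exact ⟨fun hall l hl => (Nat.lt_succ_iff_lt_or_eq.1 hl).elim (hall l) fun e => e ▸ h,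
        fun hall l hl => hall l (by omega)⟩

/-! ### The auction -/

/-- If possible, the vertex in the loop counter `4` bids for the vertex in the loop counter `5`. -/
def bid : ForProgram :=
  seq (scan (.or (.natEq (natAt 6 (ctr 6)) (.add (ctr 4) (.const 1)))
      (.conj (.conf (ctr 4) (ctr 6)) (.natLt (natAt 5 (ctr 6)) (natAt 5 (ctr 5))))))
    (cond (.conj (.natEq (natCell 4) (.const 1)) (.conj (.conf (ctr 4) (ctr 5))
        (.natLe (natAt 5 (ctr 5)) (natCell 0))))
      (seq (setNat 2 (ctr 5) (.const 0) (.add (ctr 4) (.const 1)))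
        (setNat 1 (ctr 5) (.const 0) (.add (natAt 5 (ctr 5)) (.const 1))))
      skip)

/-- The auction. -/
def auction : ForProgram :=
  seq (rep 0 (seq (setNat 1 (ctr 2) (.const 0) (.const 0)) (setNat 2 (ctr 2) (.const 0) (.const 0))))
    (rep 1 (rep 1 (rep 0 (rep 0 bid))))

theorem den_bid {n s t a b i j : ℕ} {σ : State} (hn : σ.nat 0 0 0 = n) :
    (CanBid n σ.Conf σ.price σ.owner i j →
      (bid.den [s, t, a, b, i, j] σ).price = Function.update σ.price j (σ.price j + 1) ∧
      (bid.den [s, t, a, b, i, j] σ).owner = Function.update σ.owner j (i + 1)) ∧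
    (¬ CanBid n σ.Conf σ.price σ.owner i j →
      (bid.den [s, t, a, b, i, j] σ).price = σ.price ∧
      (bid.den [s, t, a, b, i, j] σ).owner = σ.owner) := by
  classical
  set B := Test.or (.natEq (natAt 6 (ctr 6)) (.add (ctr 4) (.const 1)))
    (.conj (.conf (ctr 4) (ctr 6)) (.natLt (natAt 5 (ctr 6)) (natAt 5 (ctr 5)))) with hB
  set τ := (scan B).den [s, t, a, b, i, j] σ with hτ
  have hframe : ∀ υ, (scan B).Frame σ υ →
      υ.Conf = σ.Conf ∧ υ.price = σ.price ∧ υ.owner = σ.owner := fun υ h =>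
    ⟨State.Conf.congr (h.nat 2 (by simp [natWrites_scan])) (h.real 1 (by simp [realWrites_scan]))
      (h.real 3 (by simp [realWrites_scan])) (h.real 5 (by simp [realWrites_scan])),
      State.price_congr (h.nat 5 (by simp [natWrites_scan])),
      State.owner_congr (h.nat 6 (by simp [natWrites_scan]))⟩
  have hflag : τ.nat 4 0 0 = 1 ↔ ∀ l < n, ¬ (σ.owner l = i + 1 ∨
      σ.Conf i l ∧ σ.price l < σ.price j) := by
    refine den_scan hn fun l hl υ hυ => ?_
    obtain ⟨e1, e2, e3⟩ := hframe υ hυ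
    simp [hB, e1, e2, e3]
  obtain ⟨e1, e2, e3⟩ := hframe τ (frame_den _ _ _)
  have htest : (τ.nat 4 0 0 = 1 ∧ σ.Conf i j ∧ σ.price j ≤ n) ↔
      CanBid n σ.Conf σ.price σ.owner i j := by
    rw [hflag]
    constructor
    · rintro ⟨h1, h2, h3⟩
      exact ⟨fun l hl h => h1 l hl (Or.inl h),
        fun l hl h => not_lt.1 fun h' => h1 l hl (Or.inr ⟨h, h'⟩), h2, h3⟩
    · rintro ⟨h1, h2, h3, h4⟩
      refine ⟨fun l hl h => ?_, h3, h4⟩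
      rcases h with h | ⟨h, h'⟩
      · exact h1 l hl h
      · exact absurd (h2 l hl h) (not_le.2 h')
  have hn' : τ.nat 0 0 0 = n := (den_size _ _ _).trans hn
  have hden : bid.den [s, t, a, b, i, j] σ =
      if CanBid n σ.Conf σ.price σ.owner i j then
        ((τ.setNat 6 j 0 (i + 1)).setNat 5 j 0 (τ.price j + 1)) else τ := by
    rw [bid, den, ← hτ, den]
    simp only [Test.holds_conj, Test.holds_natEq, Test.holds_conf, Test.holds_natLe,
      eval_natCell_flag, eval_const, eval_ctr, eval_natAt_price, eval_natCell_size, e1, e2, hn']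
    simp only [List.getD_cons_succ, List.getD_cons_zero, htest]
    refine if_congr Iff.rfl ?_ rfl
    have e2j : τ.nat 5 j 0 = σ.nat 5 j 0 := congrFun e2 j
    simp [den, State.price, State.setNat, e2j]
  refine ⟨fun h => ?_, fun h => ?_⟩
  · rw [hden, if_pos h, ← e2, ← e3]
    constructor
    · funext x
      by_cases hx : x = j
      · subst hx; simp [State.price, State.setNat]
      · simp [State.price, State.setNat, hx]
    · funext x
      by_cases hx : x = j
      · subst hx; simp [State.owner, State.setNat]
      · simp [State.owner, State.setNat, hx]
  · rw [hden, if_neg h]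
    exact ⟨e2, e3⟩

theorem conf_eq_of_frame_bid {σ τ : State} (h : bid.Frame σ τ) : τ.Conf = σ.Conf :=
  State.Conf.congr (h.nat 2 (by simp [bid, scan, natWrites]))
    (h.real 1 (by simp [bid, scan, realWrites])) (h.real 3 (by simp [bid, scan, realWrites]))
    (h.real 5 (by simp [bid, scan, realWrites]))

/-- A round of the auction changes the prices, unless the auction is finished. -/
theorem den_round {n s t a b : ℕ} {σ : State} (hn : σ.nat 0 0 0 = n)
    (hI : Inv n σ.Conf σ.price σ.owner) :
    Inv n σ.Conf ((rep 0 (rep 0 bid)).den [s, t, a, b] σ).price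
      ((rep 0 (rep 0 bid)).den [s, t, a, b] σ).owner ∧
    (∑ l ∈ Finset.range n, σ.price l <
        ∑ l ∈ Finset.range n, ((rep 0 (rep 0 bid)).den [s, t, a, b] σ).price l ∧
        ¬ Finished n σ.Conf σ.price σ.owner ∨
      ((rep 0 (rep 0 bid)).den [s, t, a, b] σ).price = σ.price ∧
      ((rep 0 (rep 0 bid)).den [s, t, a, b] σ).owner = σ.owner ∧
      Finished n σ.Conf σ.price σ.owner) := by
  -- As long as no bid has been made, prices and owners are those of `σ`, so the failed tests
  -- accumulate to the statement that the auction was already finished in `σ`.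
  have := den_rep_induct (P := rep 0 bid) (c := 0) (n := n) (ρ := [s, t, a, b]) (σ := σ)
    (fun m τ => Inv n σ.Conf τ.price τ.owner ∧
      (∑ l ∈ Finset.range n, σ.price l < ∑ l ∈ Finset.range n, τ.price l ∧
        ¬ Finished n σ.Conf σ.price σ.owner ∨
        τ.price = σ.price ∧ τ.owner = σ.owner ∧
        ∀ i < m, ∀ j < n, ¬ CanBid n σ.Conf σ.price σ.owner i j)) hn
    ⟨hI, Or.inr ⟨rfl, rfl, by simp⟩⟩ ?_
  · exact this
  rintro i τ hi hτ ⟨h1, h2⟩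
  have := den_rep_induct (P := bid) (c := 0) (n := n) (ρ := [s, t, a, b] ++ [i]) (σ := τ)
    (fun m υ => Inv n σ.Conf υ.price υ.owner ∧
      (∑ l ∈ Finset.range n, σ.price l < ∑ l ∈ Finset.range n, υ.price l ∧
        ¬ Finished n σ.Conf σ.price σ.owner ∨
        υ.price = σ.price ∧ υ.owner = σ.owner ∧
        (∀ i' < i, ∀ j < n, ¬ CanBid n σ.Conf σ.price σ.owner i' j) ∧
        ∀ j < m, ¬ CanBid n σ.Conf σ.price σ.owner i j)) (hτ.size.trans hn)
    ⟨h1, h2.imp_right fun ⟨e1, e2, h⟩ => ⟨e1, e2, h, by simp⟩⟩ ?_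
  · refine ⟨this.1, this.2.imp_right fun ⟨e1, e2, h3, h4⟩ => ⟨e1, e2, fun i' hi' => ?_⟩⟩
    rcases Nat.lt_succ_iff_lt_or_eq.1 hi' with hi' | rfl
    exacts [h3 i' hi', h4]
  rintro j υ hj hυ ⟨h3, h4⟩
  have hυ' : bid.Frame σ υ := hτ.of_rep.trans hυ
  have hC := conf_eq_of_frame_bid hυ'
  obtain ⟨hyes, hno⟩ := den_bid (s := s) (t := t) (a := a) (b := b) (i := i) (j := j)
    (hυ'.size.trans hn)
  rw [hC] at hyes hno
  simp only [List.cons_append, List.nil_append]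
  by_cases hb : CanBid n σ.Conf υ.price υ.owner i j
  · obtain ⟨e1, e2⟩ := hyes hb
    rw [e1, e2, sum_bid (show j < n from hj)]
    refine ⟨h3.bid hb, Or.inl ?_⟩
    rcases h4 with ⟨h4, h5⟩ | ⟨e3, e4, -⟩
    · exact ⟨by omega, h5⟩
    · rw [e3, e4] at hb
      rw [e3]
      exact ⟨by omega, fun hf => hf i hi j hj hb⟩
  · obtain ⟨e1, e2⟩ := hno hb
    rw [e1, e2]
    refine ⟨h3, h4.imp_right ?_⟩
    rintro ⟨e3, e4, h5, h6⟩
    refine ⟨e3, e4, h5, fun j' hj' => ?_⟩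
    rcases Nat.lt_succ_iff_lt_or_eq.1 hj' with hj' | rfl
    · exact h6 j' hj'
    · rwa [e3, e4] at hb

theorem den_auction {n s t : ℕ} {σ : State} (hn : σ.nat 0 0 0 = n) :
    Inv n σ.Conf (auction.den [s, t] σ).price (auction.den [s, t] σ).owner ∧
      Finished n σ.Conf (auction.den [s, t] σ).price (auction.den [s, t] σ).owner := by
  set P0 := rep 0 (seq (setNat 1 (ctr 2) (.const 0) (.const 0))
    (setNat 2 (ctr 2) (.const 0) (.const 0))) with hP0
  set τ := P0.den [s, t] σ with hτ
  have hframe : P0.Frame σ τ := frame_den _ _ _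
  have hnτ : τ.nat 0 0 0 = n := hframe.size.trans hn
  have hC : τ.Conf = σ.Conf :=
    State.Conf.congr (hframe.nat 2 (by simp [hP0, natWrites]))
      (hframe.real 1 (by simp [hP0, realWrites])) (hframe.real 3 (by simp [hP0, realWrites]))
      (hframe.real 5 (by simp [hP0, realWrites]))
  have hzero : ∀ x < n, τ.price x = 0 ∧ τ.owner x = 0 := by
    refine den_rep_induct (c := 0) (ρ := [s, t])
      (fun m υ => ∀ x < m, υ.price x = 0 ∧ υ.owner x = 0) hn (by simp) ?_
    intro i υ hi hυ ih x hx
    simp only [den, State.price, State.owner, State.setNat]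
    rcases Nat.lt_succ_iff_lt_or_eq.1 hx with hx' | rfl
    · have := ih x hx'
      simp only [State.price, State.owner] at this
      simp [this]
    · simp
  have hI : Inv n τ.Conf τ.price τ.owner :=
    ⟨fun j hj i h => by simp [(hzero j hj).2] at h, fun j hj i h => by simp [(hzero j hj).2] at h,
      fun j hj l hl _ h => absurd (hzero j hj).2 h, fun j hj h => by simp [(hzero j hj).1] at h,
      fun j hj => by simp [(hzero j hj).1]⟩
  -- There are `(n + 1) ^ 2` rounds, and each raises the sum of the prices unless the auction is
  -- finished. The sum never exceeds `n * (n + 1)`, so the auction finishes in time.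
  have := den_rep_induct (P := rep 1 (rep 0 (rep 0 bid))) (c := 1) (n := n) (ρ := [s, t]) (σ := τ)
    (fun m υ => Inv n τ.Conf υ.price υ.owner ∧
      (m * (n + 1) ≤ ∑ l ∈ Finset.range n, υ.price l ∨ Finished n τ.Conf υ.price υ.owner)) hnτ
    ⟨hI, Or.inl (by simp)⟩ ?_
  · rw [← hC]
    refine ⟨this.1, this.2.resolve_left fun h => ?_⟩
    have := h.trans this.1.sum_le
    nlinarith
  rintro a υ ha hυ ⟨h1, h2⟩
  have := den_rep_induct (P := rep 0 (rep 0 bid)) (c := 1) (n := n) (ρ := [s, t, a]) (σ := υ)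
    (fun m ω => Inv n τ.Conf ω.price ω.owner ∧
      (a * (n + 1) + m ≤ ∑ l ∈ Finset.range n, ω.price l ∨ Finished n τ.Conf ω.price ω.owner))
    (hυ.size.trans hnτ) ⟨h1, h2⟩ ?_
  · rw [Nat.succ_mul]
    exact this
  rintro b ω hb hω ⟨h3, h4⟩
  have hω' : bid.Frame τ ω := hυ.of_rep.of_rep.of_rep.trans hω.of_rep.of_rep
  have hCω := conf_eq_of_frame_bid hω'
  rw [← hCω] at h3 h4 ⊢
  obtain ⟨h5, h6⟩ := den_round (s := s) (t := t) (a := a) (b := b) (hω'.size.trans hnτ) h3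
  simp only [List.cons_append, List.nil_append]
  refine ⟨h5, ?_⟩
  rcases h6 with ⟨h6, hnf⟩ | ⟨e1, e2, hf⟩
  · rcases h4 with h4 | hf
    · exact Or.inl (by omega)
    · exact absurd hf hnf
  · rw [e1, e2]
    exact Or.inr hf

end ForProgram

end RealRAM

/-! ### Selecting the kept terminals and extending their labels -/

namespace RealRAM

open PartiallyLabeledGraph Auction

/-- The voltages in the output array. -/
def State.voltage (σ : State) (x : ℕ) : ℝ := σ.real 2 x 0

/-- The vertex `x` is among the terminals that keep their labels. -/
def State.Kept (σ : State) (x : ℕ) : Prop := σ.nat 7 x 0 = 1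

namespace ForProgram

/-- Select the terminals that keep their labels, for the price level in the loop counter `2`, and
count the other ones. -/
def select : ForProgram :=
  seq (setNat 4 (.const 0) (.const 0) (.const 0))
    (rep 0 (seq (scan (.conj (.conf (ctr 3) (ctr 4)) (.natLt (natAt 5 (ctr 4)) (ctr 2))))
      (cond (.conj (.natEq (natAt 2 (ctr 3)) (.const 1))
          (.conj (.natEq (natCell 4) (.const 1)) (.natLt (natAt 5 (ctr 3)) (ctr 2))))
        (setNat 3 (ctr 3) (.const 0) (.const 1))
        (seq (setNat 3 (ctr 3) (.const 0) (.const 0))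
          (cond (.natEq (natAt 2 (ctr 3)) (.const 1))
            (setNat 4 (.const 0) (.const 0) (.add (natCell 8) (.const 1))) skip)))))

/-- The value that the label of the loop counter `4` allows at the loop counter `3`. -/
def bound : RealExp := .add (realAt 1 (ctr 4)) (.mul (realCell 5) (.get 3 (ctr 4) (ctr 3)))

/-- Extend the labels that are kept. -/
def extend : ForProgram :=
  rep 0 (seq (seq (setReal 0 (ctr 3) (.const 0) (.const 0))
      (setNat 0 (.const 0) (.const 0) (.const 0)))
    (rep 0 (cond (.conj (.natEq (natAt 7 (ctr 4)) (.const 1))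
        (.conj (.realLe (.const 0) (.get 3 (ctr 4) (ctr 3)))
          (.or (.neg (.natEq (natCell 4) (.const 1))) (.realLt bound (realAt 2 (ctr 3))))))
      (seq (setReal 0 (ctr 3) (.const 0) bound) (setNat 0 (.const 0) (.const 0) (.const 1)))
      skip)))

-- Only terminals are counted, because dropping a vertex without a label costs nothing.
open Classical in
theorem den_select {n s t h : ℕ} {σ : State} (hn : σ.nat 0 0 0 = n) :
    (∀ x < n, (select.den [s, t, h] σ).Kept x ↔
      σ.Terminal x ∧ ¬ Removed n σ.Conf σ.price h x) ∧
    (select.den [s, t, h] σ).nat 8 0 0 =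
      ((Finset.range n).filter fun x =>
        σ.Terminal x ∧ Removed n σ.Conf σ.price h x).card := by
  set σ' := (setNat 4 (.const 0) (.const 0) (.const 0)).den [s, t, h] σ with hσ'
  set B := Test.conj (.conf (ctr 3) (ctr 4)) (.natLt (natAt 5 (ctr 4)) (ctr 2)) with hB
  refine den_rep_induct (c := 0) (n := n) (ρ := [s, t, h]) (σ := σ')
    (fun m τ => (∀ x < m, τ.Kept x ↔ σ.Terminal x ∧ ¬ Removed n σ.Conf σ.price h x) ∧
      τ.nat 8 0 0 = ((Finset.range m).filter fun x =>
        σ.Terminal x ∧ Removed n σ.Conf σ.price h x).card)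
    ((den_size _ _ _).trans hn) ⟨by simp, by simp [hσ', den, State.setNat]⟩ ?_
  rintro x τ hx hτ ⟨h1, h2⟩
  set υ := (scan B).den [s, t, h, x] τ with hυ
  have agree : ∀ ω, (scan B).Frame τ ω → (∀ a ∉ [4, 7, 8], ω.nat a = σ.nat a) ∧
      (∀ a, ω.real a = σ.real a) := by
    intro ω hω
    refine ⟨fun a ha => ?_, fun a => ?_⟩
    · simp only [List.mem_cons, List.not_mem_nil, or_false, not_or] at ha
      rw [hω.nat a (by simp [natWrites_scan, ha]), hτ.nat a (by simp [natWrites, scan, ha])]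
      exact (frame_den _ _ _).nat a (by simp [natWrites, ha])
    · rw [hω.real a (by simp [realWrites_scan]), hτ.real a (by simp [realWrites, scan])]
      exact (frame_den _ _ _).real a (by simp [realWrites])
  have agree' : ∀ ω, (scan B).Frame τ ω →
      ω.Conf = σ.Conf ∧ ω.price = σ.price ∧ ω.nat 2 = σ.nat 2 := by
    intro ω hω
    obtain ⟨e1, e2⟩ := agree ω hω
    exact ⟨State.Conf.congr (e1 2 (by simp)) (e2 1) (e2 3) (e2 5),
      State.price_congr (e1 5 (by simp)), e1 2 (by simp)⟩
  have hυf : (scan B).Frame τ υ := frame_den _ _ _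
  have hflag : υ.nat 4 0 0 = 1 ↔ ∀ l < n, ¬ (σ.Conf x l ∧ σ.price l < h) := by
    refine den_scan (hτ.size.trans ((den_size _ _ _).trans hn)) fun l hl ω hω => ?_
    obtain ⟨e1, e2, -⟩ := agree' ω hω
    simp [hB, e1, e2]
  obtain ⟨e1, e2, e3⟩ := agree' υ hυf
  have htest : (υ.nat 4 0 0 = 1 ∧ σ.price x < h) ↔ ¬ Removed n σ.Conf σ.price h x := by
    rw [hflag, Removed]
    push Not
    exact ⟨fun h => ⟨h.2, h.1⟩, fun h => ⟨h.2, h.1⟩⟩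
  have e7 : υ.nat 7 = τ.nat 7 := hυf.nat 7 (by simp [natWrites_scan])
  have e8 : υ.nat 8 = τ.nat 8 := hυf.nat 8 (by simp [natWrites_scan])
  have hT : ∀ ρ, (natAt 2 (ctr 3)).eval (υ.withCounters ([s, t, h, x] ++ ρ)) = σ.nat 2 x 0 := by
    intro ρ
    simp [natAt, NatExp.eval, State.withCounters, e3, ctr]
  have hT0 := hT []
  rw [List.append_nil] at hT0
  set ω : State := if σ.Terminal x ∧ ¬ Removed n σ.Conf σ.price h x then υ.setNat 7 x 0 1
    else if σ.Terminal x then (υ.setNat 7 x 0 0).setNat 8 0 0 (τ.nat 8 0 0 + 1)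
    else υ.setNat 7 x 0 0 with hω
  suffices hden : (seq (scan B) (cond (.conj (.natEq (natAt 2 (ctr 3)) (.const 1))
          (.conj (.natEq (natCell 4) (.const 1)) (.natLt (natAt 5 (ctr 3)) (ctr 2))))
        (setNat 3 (ctr 3) (.const 0) (.const 1))
        (seq (setNat 3 (ctr 3) (.const 0) (.const 0))
          (cond (.natEq (natAt 2 (ctr 3)) (.const 1))
            (setNat 4 (.const 0) (.const 0) (.add (natCell 8) (.const 1))) skip)))).den
      ([s, t, h] ++ [x]) τ = ω by
    rw [hden]
    refine ⟨fun y hy => ?_, ?_⟩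
    · rcases Nat.lt_succ_iff_lt_or_eq.1 hy with hy | rfl
      · rw [← h1 y hy, hω, State.Kept, State.Kept]
        have hne : y ≠ x := hy.ne
        split_ifs <;> simp [State.setNat, e7, hne]
      · rw [hω, State.Kept]
        split_ifs with h3 h4
        · simp [State.setNat, h3]
        · simp only [h4, true_and, not_not] at h3
          simp [State.setNat, h4, h3]
        · simp [State.setNat, h4]
    · rw [Finset.range_add_one, Finset.filter_insert, hω]
      by_cases h3 : σ.Terminal x <;> by_cases h4 : Removed n σ.Conf σ.price h x <;>
        simp [State.setNat, e8, h2, h3, h4]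
  simp only [List.cons_append, List.nil_append]
  rw [den, ← hυ, den]
  simp only [Test.holds_conj, Test.holds_natEq, Test.holds_natLt, hT0,
    eval_natCell_flag, eval_const, eval_ctr, eval_natAt_price, e2]
  simp only [List.getD_cons_succ, List.getD_cons_zero, htest]
  rw [hω]
  refine if_congr Iff.rfl ?_ ?_
  · simp [den]
  · have hT1 : (natAt 2 (ctr 3)).eval ((υ.setNat 7 x 0 0).withCounters [s, t, h, x]) =
        σ.nat 2 x 0 := by
      simp [natAt, NatExp.eval, State.withCounters, State.setNat, e3, ctr]
    simp only [den, eval_ctr, eval_const, List.getD_cons_succ, List.getD_cons_zero,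
      Test.holds_natEq, hT1, Nat.reduceAdd]
    refine if_congr Iff.rfl ?_ rfl
    congr 1
    simp [natCell, NatExp.eval, State.withCounters, State.setNat, e8]

theorem den_extend {n s t h : ℕ} {σ : State} (hn : σ.nat 0 0 0 = n) :
    IsExtension n σ.Kept σ.labels (σ.real 3) (σ.real 5 0 0) (extend.den [s, t, h] σ).voltage := by
  classical
  refine den_rep_induct (c := 0) (n := n) (ρ := [s, t, h]) (σ := σ)
    (fun m τ => ∀ x < m, IsExtensionAt n σ.Kept σ.labels (σ.real 3) (σ.real 5 0 0) x
      (τ.voltage x)) hn (by simp) ?_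
  intro x τ hx hτ ih
  set P := seq (setReal 0 (ctr 3) (.const 0) (.const 0))
      (setNat 0 (.const 0) (.const 0) (.const 0)) with hP
  set τ' := P.den ([s, t, h] ++ [x]) τ with hτ'
  have hτ0 : τ' = (τ.setReal 2 x 0 0).setNat 4 0 0 0 := by
    simp [hτ', hP, den, RealExp.eval]
  set Q := cond (.conj (.natEq (natAt 7 (ctr 4)) (.const 1))
        (.conj (.realLe (.const 0) (.get 3 (ctr 4) (ctr 3)))
          (.or (.neg (.natEq (natCell 4) (.const 1))) (.realLt bound (realAt 2 (ctr 3))))))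
      (seq (setReal 0 (ctr 3) (.const 0) bound) (setNat 0 (.const 0) (.const 0) (.const 1)))
      skip with hQ
  -- A running minimum over the kept vertices that reach `x`. The flag tells whether one has been
  -- seen; until then the value is the default `0`, which must not compete in the minimum.
  have key := den_rep_induct (P := Q) (c := 0) (n := n) (ρ := [s, t, h] ++ [x]) (σ := τ')
    (fun m υ => (∀ y < x, υ.voltage y = τ.voltage y) ∧
      (∀ y < m, σ.Kept y → 0 ≤ σ.real 3 y x → υ.nat 4 0 0 = 1 ∧
        υ.voltage x ≤ σ.labels y + σ.real 5 0 0 * σ.real 3 y x) ∧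
      (υ.nat 4 0 0 = 1 → ∃ y < m, σ.Kept y ∧ 0 ≤ σ.real 3 y x ∧
        υ.voltage x = σ.labels y + σ.real 5 0 0 * σ.real 3 y x) ∧
      (υ.nat 4 0 0 ≠ 1 → υ.voltage x = 0))
    ((den_size _ _ _).trans (hτ.size.trans hn)) ?_ ?_
  · obtain ⟨h1, h2, h3, h4⟩ := key
    set υ := (rep 0 Q).den ([s, t, h] ++ [x]) τ' with hυ
    have hden : (seq P (rep 0 Q)).den ([s, t, h] ++ [x]) τ = υ := rfl
    rw [hden]
    intro y hy
    rcases Nat.lt_succ_iff_lt_or_eq.1 hy with hy | rfl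
    · rw [h1 y hy]
      exact ih y hy
    · refine ⟨fun z hz hK hd => (h2 z hz hK hd).2, ?_⟩
      by_cases hf : υ.nat 4 0 0 = 1
      · exact Or.inl (h3 hf)
      · exact Or.inr ⟨fun z hz hK hd => hf (h2 z hz hK hd).1, h4 hf⟩
  · rw [hτ0]
    refine ⟨fun y hy => ?_, by simp, by simp [State.setNat], ?_⟩
    · simp [State.voltage, State.setNat, State.setReal, hy.ne]
    · simp [State.voltage, State.setNat, State.setReal]
  · rintro z υ hz hυ ⟨h1, h2, h3, h4⟩
    have enat : ∀ a ≠ 4, υ.nat a = σ.nat a := by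
      intro a ha
      rw [hυ.nat a (by simp [hQ, natWrites, ha]), (frame_den P _ _).nat a
        (by simp [hP, natWrites, ha]), hτ.nat a (by simp [hP, hQ, natWrites, ha])]
    have ereal : ∀ a ≠ 2, υ.real a = σ.real a := by
      intro a ha
      rw [hυ.real a (by simp [hQ, realWrites, ha]), (frame_den P _ _).real a
        (by simp [hP, realWrites, ha]), hτ.real a (by simp [hP, hQ, realWrites, ha])]
    set r := σ.labels z + σ.real 5 0 0 * σ.real 3 z x with hr
    have hbound : bound.eval (υ.withCounters [s, t, h, x, z]) = r := by
      simp [bound, RealExp.eval, realAt, realCell, NatExp.eval, ctr, State.withCounters,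
        ereal, hr, State.labels]
    have hden : Q.den ([s, t, h] ++ [x] ++ [z]) υ =
        if σ.Kept z ∧ 0 ≤ σ.real 3 z x ∧ (υ.nat 4 0 0 ≠ 1 ∨ r < υ.voltage x) then
          (υ.setReal 2 x 0 r).setNat 4 0 0 1 else υ := by
      simp only [List.cons_append, List.nil_append]
      rw [hQ, den]
      refine if_congr ?_ ?_ rfl
      · simp only [Test.holds_conj, Test.holds_natEq, Test.holds_or, Test.holds_neg,
          Test.holds_realLe, Test.holds_realLt, hbound, eval_natCell_flag]
        simp [natAt, NatExp.eval, RealExp.eval, realAt, ctr, State.withCounters, enat, ereal,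
          State.Kept, State.voltage]
      · simp [den, hbound]
    rw [hden]
    split_ifs with hc
    · obtain ⟨hK, hd, hor⟩ := hc
      refine ⟨fun y hy => ?_, fun y hy hKy hdy => ?_, fun _ => ⟨z, by omega, hK, hd, ?_⟩, ?_⟩
      · rw [← h1 y hy]
        simp [State.voltage, State.setNat, State.setReal, hy.ne]
      · refine ⟨by simp [State.setNat], ?_⟩
        have : ((υ.setReal 2 x 0 r).setNat 4 0 0 1).voltage x = r := by
          simp [State.voltage, State.setNat, State.setReal]
        rw [this]
        rcases Nat.lt_succ_iff_lt_or_eq.1 hy with hy | rfl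
        · obtain ⟨h5, h6⟩ := h2 y hy hKy hdy
          rcases hor with hor | hor
          · exact absurd h5 hor
          · exact hor.le.trans h6
        · exact le_rfl
      · simp [State.voltage, State.setNat, State.setReal, hr]
      · simp [State.setNat]
    · refine ⟨h1, fun y hy hKy hdy => ?_, fun hf => ?_, h4⟩
      · rcases Nat.lt_succ_iff_lt_or_eq.1 hy with hy | rfl
        · exact h2 y hy hKy hdy
        · simp only [hKy, hdy, true_and, not_or, not_not, not_lt] at hc
          exact hc
      · obtain ⟨y, hy, h5⟩ := h3 hf
        exact ⟨y, by omega, h5⟩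

end ForProgram

end RealRAM

/-! ### The search over gradients and price levels -/

namespace RealRAM

open PartiallyLabeledGraph Auction

variable {n k : ℕ}

/-- The input and the matrix of distances are in memory. -/
structure State.Holds (G : PartiallyLabeledGraph (Fin n)) (k : ℕ) (σ : State) : Prop where
  size : σ.nat 0 0 0 = n
  outliers : σ.nat 0 0 1 = k
  labeling : G.IsLabeling σ.Terminal σ.labels
  dist : G.IsDist n (σ.real 3)

/-- A feasible assignment of gradient at most `α` has been found. -/
def State.Reached (σ : State) (α : ℝ) : Prop := σ.nat 9 0 0 = 1 ∧ σ.real 6 0 0 ≤ α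

/-- The output is feasible and its gradient is at most the recorded value. -/
def State.Sound (G : PartiallyLabeledGraph (Fin n)) (k : ℕ) (σ : State) : Prop :=
  σ.nat 9 0 0 = 1 → σ.output n ∈ G.feasible k ∧ G.gradNorm (σ.output n) ≤ σ.real 6 0 0

theorem State.Holds.of_frame {G : PartiallyLabeledGraph (Fin n)} {P : ForProgram} {σ τ : State}
    (h : σ.Holds G k) (hP : P.Frame σ τ) (h3 : 3 ∉ P.realWrites) (h1 : 1 ∉ P.realWrites) :
    τ.Holds G k := by
  have lt4 : ∀ a < 4, τ.nat a = σ.nat a := fun a ha =>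
    hP.nat a fun hm => absurd (ForProgram.four_le_of_mem_natWrites hm) (by omega)
  have e1 : τ.Terminal = σ.Terminal := by
    funext x; rw [State.Terminal, lt4 2 (by omega)]; rfl
  have e2 : τ.labels = σ.labels := by funext x; rw [State.labels, hP.real 1 h1]; rfl
  refine ⟨?_, ?_, ?_, ?_⟩
  · rw [lt4 0 (by omega), h.size]
  · rw [lt4 0 (by omega), h.outliers]
  · rw [e1, e2]; exact h.labeling
  · rw [hP.real 3 h3]; exact h.dist

namespace ForProgram

/-- Record the extension if it is feasible and has a smaller gradient than the recorded one. -/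
def record : ForProgram :=
  cond (.conj (.natLe (natCell 8) (.get 0 (.const 0) (.const 1)))
      (.or (.neg (.natEq (natCell 9) (.const 1))) (.realLt (realCell 5) (realCell 6))))
    (seq (seq (setNat 5 (.const 0) (.const 0) (.const 1))
      (setReal 4 (.const 0) (.const 0) (realCell 5))) extend)
    skip

/-- Treat the price level in the loop counter `2`. -/
def level : ForProgram := seq select record

/-- Treat the gradient that the vertices in the loop counters `0` and `1` suggest. -/
def candidate : ForProgram :=
  seq (setReal 3 (.const 0) (.const 0)
      (.div (.sub (realAt 1 (ctr 1)) (realAt 1 (ctr 0))) (.get 3 (ctr 0) (ctr 1))))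
    (cond (.realLe (.const 0) (realCell 5)) (seq auction (rep 2 level)) skip)

/-- The algorithm. -/
def outlier : ForProgram := seq distances (rep 0 (rep 0 candidate))

theorem realWrites_auction : auction.realWrites = [] := rfl

-- The three claims are soundness, persistence of what has been reached, and progress. Soundness
-- holds at every price level, since each level gives a cover of the conflicts; the right level
-- matters for progress only.
open Classical in
theorem den_level {G : PartiallyLabeledGraph (Fin n)} {s t h : ℕ} {σ : State} (hG : σ.Holds G k)
    (hα : 0 ≤ σ.real 5 0 0) (hS : σ.Sound G k) :
    (level.den [s, t, h] σ).Sound G k ∧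
    (∀ β, σ.Reached β → (level.den [s, t, h] σ).Reached β) ∧
    (((Finset.range n).filter (Removed n σ.Conf σ.price h)).card ≤ k →
      (level.den [s, t, h] σ).Reached (σ.real 5 0 0)) := by
  obtain ⟨hkept, hcount⟩ := den_select (s := s) (t := t) (h := h) hG.size
  have hframe := frame_den select [s, t, h] σ
  set τ := select.den [s, t, h] σ with hτ
  have hGτ : τ.Holds G k := hG.of_frame hframe (by decide) (by decide)
  have ereal : τ.real = σ.real := by
    funext a
    exact hframe.real a (by simp [select, realWrites, scan])
  have e9 : τ.nat 9 = σ.nat 9 := hframe.nat 9 (by decide)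
  set υ := (seq (setNat 5 (.const 0) (.const 0) (.const 1))
      (setReal 4 (.const 0) (.const 0) (realCell 5))).den [s, t, h] τ with hυ
  have hυ' : υ = (τ.setNat 9 0 0 1).setReal 6 0 0 (σ.real 5 0 0) := by
    have e : (τ.setNat 9 0 0 1).real = σ.real := ereal
    simp [hυ, den, realCell, RealExp.eval, NatExp.eval, State.withCounters, e]
  have hext := den_extend (n := n) (s := s) (t := t) (h := h) (σ := υ)
    ((den_size _ _ _).trans hGτ.size)
  have hfe := frame_den extend [s, t, h] υ
  set ω := extend.den [s, t, h] υ with hω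
  have hden : level.den [s, t, h] σ =
      if τ.nat 8 0 0 ≤ k ∧ (σ.nat 9 0 0 ≠ 1 ∨ σ.real 5 0 0 < σ.real 6 0 0) then ω else τ := by
    rw [level, den, ← hτ, record, den]
    refine if_congr ?_ rfl rfl
    have e1 : (NatExp.get 0 (.const 0) (.const 1)).eval (τ.withCounters [s, t, h]) = k := by
      simp [NatExp.eval, State.withCounters, hGτ.outliers]
    simp only [Test.holds_conj, Test.holds_or, Test.holds_natLe, e1, Test.holds_neg,
      Test.holds_natEq, Test.holds_realLt]
    simp [natCell, realCell, NatExp.eval, RealExp.eval, State.withCounters, e9, ereal]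
  have hω9 : ω.nat 9 0 0 = 1 := by
    rw [hfe.nat 9 (by decide), hυ']
    simp [State.setReal, State.setNat]
  have hω6 : ω.real 6 0 0 = σ.real 5 0 0 := by
    rw [hfe.real 6 (by decide), hυ']
    simp [State.setReal]
  rw [hden]
  split_ifs with hc
  · refine ⟨fun _ => ?_, fun β hβ => ⟨hω9, ?_⟩, fun _ => ⟨hω9, hω6.le⟩⟩
    · have eK : υ.Kept = τ.Kept := by rw [hυ']; rfl
      have e3 : υ.real 3 = σ.real 3 := by
        rw [hυ']; funext x y; simp [State.setReal, State.setNat, ereal]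
      have e5 : υ.real 5 0 0 = σ.real 5 0 0 := by
        rw [hυ']; simp [State.setReal, State.setNat, ereal]
      have eL : υ.labels = σ.labels := by
        rw [hυ']; funext x; simp [State.labels, State.setReal, State.setNat, ereal]
      rw [eK, e3, e5, eL] at hext
      -- `select` says nothing about flags at indices from `n` on, so the kept set is cut down to
      -- actual vertices.
      have hext' : IsExtension n (fun x => x < n ∧ τ.Kept x) σ.labels (σ.real 3) (σ.real 5 0 0)
          ω.voltage := by
        intro x hx
        obtain ⟨h1, h2⟩ := hext x hx
        refine ⟨fun y hy hK => h1 y hy hK.2, h2.imp ?_ ?_⟩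
        · rintro ⟨y, hy, hK, h3⟩
          exact ⟨y, hy, ⟨hy, hK⟩, h3⟩
        · rintro ⟨h3, h4⟩
          exact ⟨fun y hy hK => h3 y hy hK.2, h4⟩
      rw [hω6]
      refine ⟨hext'.mem_feasible hG.dist hG.labeling (fun x hx => ((hkept x hx.1).1 hx.2).1) ?_ ?_,
        hext'.gradNorm_le hG.dist hα⟩
      · intro x y hx hy hxy
        rcases removed_or_removed (p := σ.price) h hy.1 hxy with hr | hr
        · exact ((hkept x hx.1).1 hx.2).2 hr
        · exact ((hkept y hy.1).1 hy.2).2 hr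
      · refine le_trans (Finset.card_le_card fun x hx => ?_) (hcount ▸ hc.1)
        simp only [Finset.mem_filter, Finset.mem_range, not_and] at hx ⊢
        refine ⟨hx.1, hx.2.1, ?_⟩
        by_contra hr
        exact hx.2.2 hx.1 ((hkept x hx.1).2 ⟨hx.2.1, hr⟩)
    · rw [hω6]
      rcases hc.2 with h1 | h1
      · exact absurd hβ.1 h1
      · exact h1.le.trans hβ.2
  · have hreach : ∀ β, σ.Reached β → τ.Reached β := by
      intro β hβ
      rw [State.Reached, e9, ereal]
      exact hβ
    refine ⟨fun h9 => ?_, hreach, fun hcard => ?_⟩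
    · rw [e9] at h9
      have : τ.output n = σ.output n := by funext i; rw [State.output, ereal]; rfl
      rw [this, ereal]
      exact hS h9
    · have h8 : τ.nat 8 0 0 ≤ k := by
        rw [hcount]
        refine le_trans (Finset.card_le_card fun x hx => ?_) hcard
        simp only [Finset.mem_filter] at hx ⊢
        exact ⟨hx.1, hx.2.2⟩
      simp only [h8, true_and, not_or, not_not, not_lt] at hc
      exact hreach _ hc

theorem den_candidate {G : PartiallyLabeledGraph (Fin n)} {s t : ℕ} {σ : State} {α : ℝ}
    (hG : σ.Holds G k) (hα : α = (σ.labels t - σ.labels s) / σ.real 3 s t) (hS : σ.Sound G k) :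
    (candidate.den [s, t] σ).Sound G k ∧
    (∀ β, σ.Reached β → (candidate.den [s, t] σ).Reached β) ∧
    (0 ≤ α → (∃ A : Finset ℕ, A.card ≤ k ∧
        ∀ x y, Conflict σ.Terminal σ.labels (σ.real 3) α x y → x ∈ A ∨ y ∈ A) →
      (candidate.den [s, t] σ).Reached α) := by
  classical
  set τ := (setReal 3 (.const 0) (.const 0)
      (.div (.sub (realAt 1 (ctr 1)) (realAt 1 (ctr 0))) (.get 3 (ctr 0) (ctr 1)))).den [s, t] σ
    with hτ
  have hτ' : τ = σ.setReal 5 0 0 α := by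
    simp [hτ, den, realAt, RealExp.eval, NatExp.eval, State.withCounters, ctr, hα, State.labels]
  have hGτ : τ.Holds G k := hG.of_frame (frame_den _ _ _) (by simp [realWrites])
    (by simp [realWrites])
  have e5 : τ.real 5 0 0 = α := by rw [hτ']; simp [State.setReal]
  have hSτ : τ.Sound G k := by
    have h1 : τ.output n = σ.output n := by
      rw [hτ']; funext i; simp [State.output, State.setReal]
    have h2 : τ.real 6 0 0 = σ.real 6 0 0 := by rw [hτ']; simp [State.setReal]
    intro h9
    rw [h1, h2]
    exact hS (by rw [hτ'] at h9; exact h9)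
  have hRτ : ∀ β, σ.Reached β → τ.Reached β := by
    intro β hβ
    rw [hτ']
    simpa [State.Reached, State.setReal] using hβ
  have hCτ : τ.Conf = Conflict σ.Terminal σ.labels (σ.real 3) α := by
    have e1 : τ.labels = σ.labels := by
      rw [hτ']; funext x; simp [State.labels, State.setReal]
    have e3 : τ.real 3 = σ.real 3 := by
      rw [hτ']; funext x y; simp [State.setReal]
    have e2 : τ.Terminal = σ.Terminal := by rw [hτ']; rfl
    rw [State.Conf, e1, e2, e3, e5]
  have htest : (Test.realLe (.const 0) (realCell 5)).Holds (τ.withCounters [s, t]) ↔ 0 ≤ α := by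
    simp [realCell, RealExp.eval, NatExp.eval, State.withCounters, e5]
  have hden : candidate.den [s, t] σ =
      if 0 ≤ α then (rep 2 level).den [s, t] (auction.den [s, t] τ) else τ := by
    rw [candidate, den, ← hτ, den]
    exact if_congr htest rfl rfl
  rw [hden]
  split_ifs with h0
  swap
  · exact ⟨hSτ, hRτ, fun h => absurd h h0⟩
  obtain ⟨hI, hF⟩ := den_auction (s := s) (t := t) hGτ.size
  have hfa := frame_den auction [s, t] τ
  set υ := auction.den [s, t] τ with hυ
  have hGυ : υ.Holds G k := hGτ.of_frame hfa (by decide) (by decide)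
  have hrυ : υ.real = τ.real := by
    funext a
    exact hfa.real a (by simp [realWrites_auction])
  have h9υ : υ.nat 9 = τ.nat 9 := hfa.nat 9 (by decide)
  have hCυ : υ.Conf = τ.Conf := State.Conf.congr (hfa.nat 2 (by decide)) (by rw [hrυ])
    (by rw [hrυ]) (by rw [hrυ])
  rw [← hCυ] at hI hF
  have key := den_rep_induct (P := level) (c := 2) (n := n) (ρ := [s, t]) (σ := υ)
    (fun m ω => ω.Sound G k ∧ (∀ β, σ.Reached β → ω.Reached β) ∧
      ∀ h < m, ((Finset.range n).filter (Removed n υ.Conf υ.price h)).card ≤ k → ω.Reached α)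
    hGυ.size ⟨?_, ?_, by simp⟩ ?_
  · obtain ⟨h1, h2, h3⟩ := key
    -- Removed vertices at a suitable level ≤ size of the matching ≤ size of any cover `A` ≤ `k`.
    -- The loop over `n + 2` levels includes this level.
    refine ⟨h1, h2, fun _ ⟨A, hA, hAc⟩ => ?_⟩
    obtain ⟨h, hh, hcard⟩ := hI.exists_card_removed_le hF
    refine h3 h hh (hcard.trans ((hI.card_owned_le ?_ ?_).trans hA))
    · rw [hCυ, hCτ]
      exact fun x y z => Conflict.trans hG.dist hG.labeling h0
    · rw [hCυ, hCτ]
      exact hAc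
  · intro h9
    rw [h9υ] at h9
    have : υ.output n = τ.output n := by funext i; rw [State.output, hrυ]; rfl
    rw [this, hrυ]
    exact hSτ h9
  · intro β hβ
    rw [State.Reached, h9υ, hrυ]
    exact hRτ β hβ
  · rintro h ω hh hω ⟨h1, h2, h3⟩
    have hGω : ω.Holds G k := hGυ.of_frame hω (by decide) (by decide)
    have e5ω : ω.real 5 0 0 = α := by rw [hω.real 5 (by decide), hrυ, e5]
    have hCω : ω.Conf = υ.Conf := State.Conf.congr (hω.nat 2 (by decide))
      (hω.real 1 (by decide)) (hω.real 3 (by decide)) (hω.real 5 (by decide))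
    have hpω : ω.price = υ.price := State.price_congr (hω.nat 5 (by decide))
    obtain ⟨h4, h5, h6⟩ := den_level (s := s) (t := t) (h := h) hGω (by rw [e5ω]; exact h0) h1
    rw [e5ω, hCω, hpω] at h6
    refine ⟨h4, fun β hβ => h5 β (h2 β hβ), fun h' hh' hcard => ?_⟩
    rcases Nat.lt_succ_iff_lt_or_eq.1 hh' with hh' | rfl
    · exact h5 _ (h3 h' hh' hcard)
    · exact h6 hcard

theorem isLabeling_input (G : PartiallyLabeledGraph (Fin n)) :
    G.IsLabeling (input k G).Terminal (input k G).labels := by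
  classical
  have hT : ∀ i, (input k G).Terminal i ↔ ∃ x : Fin n, (x : ℕ) = i ∧ x ∈ G.terminals := by
    intro i
    simp [State.Terminal, input]
  have hL : ∀ x : Fin n, (input k G).labels x = (G.label x).getD 0 := by
    intro x
    simp [State.labels, input]
  refine ⟨fun i hi => ?_, fun x hx => ?_, fun x hx => ?_⟩
  · obtain ⟨x, rfl, -⟩ := (hT i).1 hi
    exact x.2
  · obtain ⟨y, hy, hyT⟩ := (hT x).1 hx
    obtain rfl := Fin.ext hy
    obtain ⟨a, ha⟩ := Option.ne_none_iff_exists'.1 hyT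
    rw [hL, ha]
    rfl
  · by_contra h
    exact hx ((hT x).2 ⟨x, rfl, h⟩)

theorem holds_distances (G : PartiallyLabeledGraph (Fin n)) :
    (distances.den [] (input k G)).Holds G k := by
  have hf := frame_den distances [] (input k G)
  have e1 : (distances.den [] (input k G)).Terminal = (input k G).Terminal := by
    funext x; rw [State.Terminal, hf.nat 2 (by decide)]; rfl
  have e2 : (distances.den [] (input k G)).labels = (input k G).labels := by
    funext x; rw [State.labels, hf.real 1 (by decide)]; rfl
  refine ⟨?_, ?_, ?_, isDist_distances G⟩
  · rw [hf.size]; simp [input]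
  · rw [hf.nat 0 (by decide)]; simp [input]
  · rw [e1, e2]; exact isLabeling_input G

theorem isOptimal_outlier (G : PartiallyLabeledGraph (Fin n)) :
    G.IsOptimal k ((outlier.den [] (input k G)).output n) := by
  -- Without vertices there is no candidate pair, but also only one assignment.
  rcases Nat.eq_zero_or_pos n with rfl | hn
  · have hall : ∀ v w : Fin 0 → ℝ, v = w := fun v w => Subsingleton.elim v w
    refine ⟨?_, fun v _ => by rw [Set.mem_ofPred_eq, hall v]⟩
    change PartiallyLabeledGraph.labelDist _ _ ≤ k
    simp [PartiallyLabeledGraph.labelDist, Set.eq_empty_of_isEmpty]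
  have hG : (distances.den [] (input k G)).Holds G k := holds_distances G
  have h9 : (distances.den [] (input k G)).nat 9 0 0 = 0 := by
    rw [(frame_den distances [] (input k G)).nat 9 (by decide)]
    simp [input]
  set σ := distances.den [] (input k G) with hσ
  set α : ℕ → ℕ → ℝ := fun s t => (σ.labels t - σ.labels s) / σ.real 3 s t with hα
  set Good : ℕ → ℕ → State → Prop := fun s t τ => 0 ≤ α s t → (∃ A : Finset ℕ, A.card ≤ k ∧
    ∀ x y, Conflict σ.Terminal σ.labels (σ.real 3) (α s t) x y → x ∈ A ∨ y ∈ A) →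
      τ.Reached (α s t) with hGood
  have key := den_rep_induct (P := rep 0 candidate) (c := 0) (n := n) (ρ := []) (σ := σ)
    (fun m τ => τ.Sound G k ∧ ∀ s < m, ∀ t < n, Good s t τ) hG.size
    ⟨fun h => by simp [h9] at h, by simp⟩ ?_
  · have hout : outlier.den [] (input k G) = (rep 0 (rep 0 candidate)).den [] σ := rfl
    rw [hout]
    set τ := (rep 0 (rep 0 candidate)).den [] σ
    obtain ⟨hS, hR⟩ := key
    have hbest : ∀ v ∈ G.feasible k, τ.Reached (G.gradNorm v) := by
      intro v hv
      obtain ⟨s, hs, t, ht, h0, hle, hA⟩ := exists_quotient hn hG.dist hG.labeling hv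
      obtain ⟨h1, h2⟩ := hR s hs t ht h0 hA
      exact ⟨h1, h2.trans hle⟩
    -- Some feasible assignment exists, namely the given labels filled up with `0`; hence something
    -- has been recorded.
    have hex : (fun x : Fin n => (G.label x).getD 0) ∈ G.feasible k := by
      change PartiallyLabeledGraph.labelDist _ _ ≤ k
      have : {t | t ∈ G.terminals ∧ G.label t ≠ some ((G.label t).getD 0)} = ∅ := by
        refine Set.eq_empty_of_forall_notMem fun x hx => ?_
        obtain ⟨a, ha⟩ := Option.ne_none_iff_exists'.1 hx.1
        exact hx.2 (by rw [ha]; rfl)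
      rw [PartiallyLabeledGraph.labelDist, this, Set.ncard_empty]
      exact Nat.zero_le k
    obtain ⟨h1, h2⟩ := hS (hbest _ hex).1
    exact ⟨h1, fun v hv => h2.trans (hbest v hv).2⟩
  rintro s τ hs hτ ⟨h1, h2⟩
  have key := den_rep_induct (P := candidate) (c := 0) (n := n) (ρ := [s]) (σ := τ)
    (fun m υ => υ.Sound G k ∧ (∀ s' < s, ∀ t < n, Good s' t υ) ∧ ∀ t < m, Good s t υ)
    (hτ.size.trans hG.size) ⟨h1, h2, by simp⟩ ?_
  · refine ⟨key.1, fun s' hs' => ?_⟩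
    rcases Nat.lt_succ_iff_lt_or_eq.1 hs' with hs' | rfl
    exacts [key.2.1 s' hs', key.2.2]
  rintro t υ ht hυ ⟨h3, h4, h5⟩
  have hf : candidate.Frame σ υ := hτ.of_rep.trans hυ
  have hGυ : υ.Holds G k := hG.of_frame hf (by decide) (by decide)
  have e1 : υ.labels = σ.labels := by funext x; rw [State.labels, hf.real 1 (by decide)]; rfl
  have e2 : υ.Terminal = σ.Terminal := by funext x; rw [State.Terminal, hf.nat 2 (by decide)]; rfl
  have e3 : υ.real 3 = σ.real 3 := hf.real 3 (by decide)
  obtain ⟨h6, h7, h8⟩ := den_candidate (s := s) (t := t) (α := α s t) hGυ (by rw [e1, e3]) h3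
  rw [e1, e2, e3] at h8
  simp only [List.cons_append, List.nil_append]
  have mono : ∀ s' t', Good s' t' υ → Good s' t' (candidate.den [s, t] υ) :=
    fun s' t' hg h0 hA => h7 _ (hg h0 hA)
  refine ⟨h6, fun s' hs' t' ht' => mono _ _ (h4 s' hs' t' ht'), fun t' ht' => ?_⟩
  rcases Nat.lt_succ_iff_lt_or_eq.1 ht' with ht' | rfl
  exacts [mono _ _ (h5 t' ht'), h8]

end ForProgram

theorem withCounters_input (G : PartiallyLabeledGraph (Fin n)) :
    (input k G).withCounters [] = input k G := by
  simp only [State.withCounters, input, State.mk.injEq, and_true]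
  funext a i j
  by_cases ha : a = 3
  · simp [ha]
  · simp [ha]

end RealRAM

theorem mainTheorem7 :
    ∃ (outlier : RealRAM.Program) (p : Polynomial ℕ),
      ∀ (n k : ℕ) (_ : 0 < k) (G : PartiallyLabeledGraph (Fin n)),
        ∃ (σ : RealRAM.State) (t : ℕ),
          RealRAM.Runs outlier (RealRAM.input k G) σ t ∧
          t ≤ p.eval n ∧
          G.IsOptimal k (σ.output n) := by
  obtain ⟨p, hp⟩ := RealRAM.ForProgram.outlier.runs_compile 0
  refine ⟨RealRAM.ForProgram.outlier.compile 0, p, fun n k _ G => ?_⟩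
  obtain ⟨t, ht, hle⟩ := hp [] (RealRAM.input k G) rfl
  have hn : (RealRAM.input k G).nat 0 0 0 = n := by simp [RealRAM.input]
  -- The counter array is zero in the input, as it is for an empty list of counters.
  rw [RealRAM.withCounters_input] at ht
  rw [hn] at hle
  exact ⟨_, t, ht, hle, RealRAM.ForProgram.isOptimal_outlier G⟩
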